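/- Let $E$ be a finite-dimensional real vector space with a Euclidean norm $\|\cdot\|$, and for $q\ge 0$ put $f_q(x)=\|x\|^q$ (with $0^0=1$). The norm of a $p$-multilinear form $L$ on $E$ is $\|L\|=\max_{\|h_1\|=\dots=\|h_p\|=1}|L[h_1,\dots,h_p]|$. Define polynomials $g_{p,q}$ by $g_{0,q}=1$ and $g_{p,q}(\tau)=(1-\tau^2)g_{p-1,q}'(\tau)+(q-p+1)\,\tau\, g_{p-1,q}(\tau)$ for $p\ge1$. For an integer $p\ge 0$ and a real $\nu\in[0,1]$ let $$H_{p,\nu}=\sup_{0\le\tau_1<\tau_2\le1}\frac{g_{p,p+\nu}(\tau_2)-g_{p,p+\nu}(\tau_1)}{(\tau_2-\tau_1)^\nu}$$ be the $\nu$-Hölder constant of $g_{p,p+\nu}$ on $[0,1]$, and let $$A_{p,\nu}=\begin{cases}(p-1)!!\prod_{i=1}^{p/2}(\nu+2i)+H_{p,\nu},& p\text{ even},\\ 2^{1-\nu}\prod_{i=1}^{p}(\nu+i),& p\text{ odd},\end{cases}\qquad \tilde A_{p,\nu}=\begin{cases}(p-1)!!\prod_{i=1}^{p/2}(\nu+2i)+\prod_{i=1}^{p}(\nu+i),&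 p\text{ even},\\ 2^{1-\nu}\prod_{i=1}^{p}(\nu+i),& p\text{ odd},\end{cases}$$ where $(-1)!!=1$. Theorem. Let $p\ge0$ be an integer and $\nu\in[0,1]$. The function $f_{p+\nu}$ is $p$ times continuously differentiable on $E\setminus\{0\}$, and on all of $E$ if $\nu>0$ or $p$ is even; if $\nu=0$ and $p$ is odd, put $D^pf_{p}(0):=0$. The supremum $H_{p,\nu}$ is finite, and $$\|D^pf_{p+\nu}(x_2)-D^pf_{p+\nu}(x_1)\|\le A_{p,\nu}\,\|x_2-x_1\|^{\nu}\qquad\text{for all }x_1,x_2\in E.$$ Moreover $A_{p,\nu}\le\tilde A_{p,\nu}$, so the same inequality holds with $\tilde A_{p,\nu}$ in place of $A_{p,\nu}$. Suppose in addition that $E\ne\{0\}$. If $p$ is odd, then $\tilde A_{p,\nu}$ is optimal: every real $M$ with $\|D^pf_{p+\nu}(x_2)-D^pf_{p+\nu}(x_1)\|\le M\|x_2-x_1\|^\nu$ for all nonzero $x_1,x_2\in E$ satisfies $\tilde A_{p,\nu}\le M$. If $p$ is even and $\nu>0$, then $\tilde A_{p,\nu}$ is at most twice the optimal constant: every real $M$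 with $\|D^pf_{p+\nu}(x_2)-D^pf_{p+\nu}(x_1)\|\le M\|x_2-x_1\|^\nu$ for all $x_1,x_2\in E$ satisfies $\tilde A_{p,\nu}\le 2M$. -/

import Mathlib

noncomputable section

/-- The power `f_q(x) = ‖x‖ ^ q` of the Euclidean norm. -/
def normPow (E : Type*) [NormedAddCommGroup E] (q : ℝ) (x : E) : ℝ := ‖x‖ ^ q

/-- The polynomials `g_{p,q}`: `g_{0,q} = 1` and
`g_{p+1,q}(τ) = (1 - τ²) g_{p,q}'(τ) + (q - p) τ g_{p,q}(τ)`. -/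
def gPoly : ℕ → ℝ → Polynomial ℝ
  | 0, _ => 1
  | p + 1, q =>
      (1 - Polynomial.X ^ 2) * Polynomial.derivative (gPoly p q)
        + Polynomial.C (q - (p : ℝ)) * Polynomial.X * gPoly p q

/-- The quotients `(g(τ₂) - g(τ₁)) / (τ₂ - τ₁)^ν`, `0 ≤ τ₁ < τ₂ ≤ 1`, for `g = g_{p,p+ν}`. -/
def holderQuotients (p : ℕ) (ν : ℝ) : Set ℝ :=
  {r | ∃ s t : ℝ, 0 ≤ s ∧ s < t ∧ t ≤ 1 ∧
    r = ((gPoly p (p + ν)).eval t - (gPoly p (p + ν)).eval s) / (t - s) ^ ν}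

/-- `H_{p,ν}`, the `ν`-Hölder constant of `g_{p,p+ν}` on `[0,1]` (a supremum; for `ν = 1` it
need not be attained). -/
def hConst (p : ℕ) (ν : ℝ) : ℝ := sSup (holderQuotients p ν)

/-- The constant `A_{p,ν}`. For `p = 0` the truncated `p - 1 = 0` gives `0‼ = 1 = (-1)‼`. -/
def aConst (p : ℕ) (ν : ℝ) : ℝ :=
  if Even p then
    (Nat.doubleFactorial (p - 1) : ℝ) * ∏ i ∈ Finset.Icc 1 (p / 2), (ν + 2 * (i : ℝ))
      + hConst p ν
  else (2 : ℝ) ^ (1 - ν) * ∏ i ∈ Finset.Icc 1 p, (ν + (i : ℝ))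

/-- The explicit constant `Ã_{p,ν}`. -/
def aTildeConst (p : ℕ) (ν : ℝ) : ℝ :=
  if Even p then
    (Nat.doubleFactorial (p - 1) : ℝ) * ∏ i ∈ Finset.Icc 1 (p / 2), (ν + 2 * (i : ℝ))
      + ∏ i ∈ Finset.Icc 1 p, (ν + (i : ℝ))
  else (2 : ℝ) ^ (1 - ν) * ∏ i ∈ Finset.Icc 1 p, (ν + (i : ℝ))

/-- `F` is `ν`-Hölder continuous on `S` with (real) constant `M`. -/
def HolderOnWithConst {E G : Type*} [NormedAddCommGroup E] [NormedAddCommGroup G]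
    (M ν : ℝ) (F : E → G) (S : Set E) : Prop :=
  ∀ x₁ ∈ S, ∀ x₂ ∈ S, ‖F x₂ - F x₁‖ ≤ M * ‖x₂ - x₁‖ ^ ν

end

/-! ### The polynomials `gPoly`: differential equation, end values, sign and monotonicity on [0,1].
-/

namespace NormPower

open Polynomial

/-! For x ≠ 0 and a unit vector h, differentiating along h gives D^p f_q(x)[h,…,h] =
g_{p,q}(τ)‖x‖^{q-p} with τ = ⟪x,h⟫/‖x‖ (`iteratedFDeriv_normPow_diag`). A symmetric form on a
Euclidean space attains its norm on the diagonal (`norm_le_of_diagonal`), so it suffices to bound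
the increments of the scalar functions `axial g ν h`.

If x and y lie on the same side of the hyperplane h^⊥, the increment is controlled by g(0) and a
ν-Hölder constant of g on [0,1]. Otherwise, for even p one point is reflected in h^⊥; for odd p the
segment is cut at h^⊥, and concavity of t^ν yields the factor 2^{1-ν}.

The explicit constants rest on H_{p,ν} ≤ g(1) (`gPoly_eval_sub_le`): a pair violating it with
maximal excess satisfies first and second order conditions that contradict the Gegenbauer equation.
The lower bounds come from the pair ±h for odd p, and from 0 and h for even p. -/

theorem gPoly_succ (p : ℕ) (q : ℝ) :
    gPoly (p + 1) q = (1 - X ^ 2) * derivative (gPoly p q) + C (q - (p : ℝ)) * X * gPoly p q := rfl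

/-- Differentiating the recursion produces a second derivative, which the differential equation at
level p eliminates. The equation is a hypothesis so that the induction in `gPoly_ode` can use this
formula. -/
theorem derivative_gPoly_succ_of_ode {p : ℕ} {q : ℝ}
    (h : (1 - X ^ 2) * derivative (derivative (gPoly p q))
      + C (q - 1) * X * derivative (gPoly p q) + C ((p : ℝ) * (p - q)) * gPoly p q = 0) :
    derivative (gPoly (p + 1) q)
      = C ((p : ℝ) + 1) * (C (q - p) * gPoly p q - X * derivative (gPoly p q)) := by
  rw [gPoly_succ]
  simp only [derivative_add, derivative_mul, derivative_sub, derivative_one, derivative_X_pow,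
    derivative_X, derivative_C]
  simp only [map_sub, map_add, map_mul, map_one, Nat.cast_ofNat, map_ofNat] at h ⊢
  linear_combination h

/-- The Gegenbauer differential equation. -/
theorem gPoly_ode (p : ℕ) (q : ℝ) :
    (1 - X ^ 2) * derivative (derivative (gPoly p q)) + C (q - 1) * X * derivative (gPoly p q)
      + C ((p : ℝ) * (p - q)) * gPoly p q = 0 := by
  induction p with
  | zero => simp [gPoly]
  | succ p ih =>
    rw [derivative_gPoly_succ_of_ode ih, gPoly_succ]
    simp only [derivative_mul, derivative_sub, derivative_X, derivative_C]
    push_cast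
    simp only [map_sub, map_add, map_mul, map_one] at ih ⊢
    linear_combination (-(C (p : ℝ) + 1) * X) * ih

theorem derivative_gPoly_succ_eq_sub (p : ℕ) (q : ℝ) :
    derivative (gPoly (p + 1) q)
      = C ((p : ℝ) + 1) * (C (q - p) * gPoly p q - X * derivative (gPoly p q)) :=
  derivative_gPoly_succ_of_ode (gPoly_ode p q)

/-- Makes g'_{p+1,q} a multiple of g_{p,q-2}, so that signs of derivatives follow from signs of the
polynomials. The shift by 2 mirrors ∇‖x‖^q = q‖x‖^{q-2}x. -/
theorem gPoly_sub_two (p : ℕ) (q : ℝ) :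
    C q * gPoly p (q - 2) = C (q - p) * gPoly p q - X * derivative (gPoly p q) := by
  induction p with
  | zero => simp [gPoly]
  | succ p ih =>
    have ode := gPoly_ode p q
    have ih' := congrArg derivative ih
    rw [derivative_gPoly_succ_eq_sub, gPoly_succ, gPoly_succ]
    simp only [derivative_mul, derivative_sub, derivative_X, derivative_C] at ih'
    push_cast
    simp only [map_sub, map_add, map_mul, map_one, map_ofNat] at ih ih' ode ⊢
    linear_combination (1 - X ^ 2) * ih' + (C q - 2 - C (p : ℝ)) * X * ih - X * ode

theorem derivative_gPoly_succ (p : ℕ) (q : ℝ) :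
    derivative (gPoly (p + 1) q) = C (((p : ℝ) + 1) * q) * gPoly p (q - 2) := by
  rw [derivative_gPoly_succ_eq_sub, ← gPoly_sub_two]
  simp only [map_mul, mul_assoc]

theorem gPoly_eval_neg (p : ℕ) (q t : ℝ) :
    (gPoly p q).eval (-t) = (-1) ^ p * (gPoly p q).eval t := by
  have key : (gPoly p q).comp (-X) = C ((-1 : ℝ) ^ p) * gPoly p q := by
    induction p with
    | zero => simp [gPoly]
    | succ p ih =>
      have hd := congrArg derivative ih
      simp only [derivative_comp, derivative_neg, derivative_X, derivative_mul, derivative_C] at hd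
      rw [gPoly_succ]
      simp only [add_comp, mul_comp, sub_comp, one_comp, pow_comp, X_comp, C_comp, ih]
      rw [pow_succ (-1 : ℝ)]
      simp only [map_mul, map_neg, map_one]
      linear_combination (X ^ 2 - 1) * hd
  have := congrArg (eval t) key
  simpa using this

theorem gPoly_eval_one (p : ℕ) (q : ℝ) :
    (gPoly p q).eval 1 = ∏ i ∈ Finset.range p, (q - i) := by
  induction p with
  | zero => simp [gPoly]
  | succ p ih =>
    rw [gPoly_succ, Finset.prod_range_succ, ← ih]
    simp [mul_comm]

theorem gPoly_eval_one_eq (p : ℕ) (ν : ℝ) :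
    (gPoly p (p + ν)).eval 1 = ∏ i ∈ Finset.Icc 1 p, (ν + (i : ℝ)) := by
  rw [gPoly_eval_one, ← Finset.prod_range_reflect, Finset.range_eq_Ico,
    Finset.prod_Ico_eq_prod_range]
  have : Finset.Icc 1 p = Finset.Ico 1 (p + 1) := by ext; simp
  rw [this, Finset.prod_Ico_eq_prod_range]
  refine Finset.prod_congr (by simp) fun i hi => ?_
  have hi : i < p := by simpa using hi
  have : ((p - 1 - (0 + i) : ℕ) : ℝ) = p - 1 - i := by
    rw [Nat.cast_sub (by omega), Nat.cast_sub (by omega)]; simp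
  rw [this]
  push_cast
  ring

theorem gPoly_eval_zero_add_two (p : ℕ) (q : ℝ) :
    (gPoly (p + 2) q).eval 0 = (p + 1) * (q - p) * (gPoly p q).eval 0 := by
  rw [gPoly_succ, derivative_gPoly_succ_eq_sub]
  simp
  ring

theorem gPoly_eval_zero_even (k : ℕ) (q : ℝ) :
    (gPoly (2 * k) q).eval 0
      = (Nat.doubleFactorial (2 * k - 1) : ℝ) * ∏ i ∈ Finset.range k, (q - 2 * i) := by
  induction k with
  | zero => simp [gPoly]
  | succ k ih =>
    have h : ((2 * (k + 1) - 1).doubleFactorial : ℝ) = (2 * k + 1) * (2 * k - 1).doubleFactorial := by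
      -- At k = 0 the truncated 2k - 1 is 0, and 0‼ = 1 plays the role of (-1)‼.
      rcases k with _ | k
      · simp
      · have : 2 * (k + 1 + 1) - 1 = (2 * (k + 1) - 1) + 2 := by omega
        rw [this, Nat.doubleFactorial_add_two]
        have : 2 * (k + 1) - 1 + 2 = 2 * (k + 1) + 1 := by omega
        rw [this]
        push_cast
        ring
    rw [show 2 * (k + 1) = 2 * k + 2 by ring, gPoly_eval_zero_add_two, ih,
      Finset.prod_range_succ, show 2 * k + 2 - 1 = 2 * (k + 1) - 1 by omega, h]
    push_cast
    ring

theorem gPoly_eval_zero_of_even {p : ℕ} (hp : Even p) (ν : ℝ) :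
    (gPoly p (p + ν)).eval 0 = (Nat.doubleFactorial (p - 1) : ℝ) *
      ∏ i ∈ Finset.Icc 1 (p / 2), (ν + 2 * (i : ℝ)) := by
  obtain ⟨k, hk⟩ := hp
  obtain rfl : p = 2 * k := by omega
  rw [gPoly_eval_zero_even, Nat.mul_div_cancel_left k two_pos, ← Finset.prod_range_reflect]
  have : Finset.Icc 1 k = Finset.Ico 1 (k + 1) := by ext; simp
  rw [this, Finset.prod_Ico_eq_prod_range]
  congr 1
  refine Finset.prod_congr (by simp) fun i hi => ?_
  have hi : i < k := by simpa using hi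
  have : ((k - 1 - i : ℕ) : ℝ) = k - 1 - i := by
    rw [Nat.cast_sub (by omega), Nat.cast_sub (by omega)]; simp
  rw [this]
  push_cast
  ring

theorem gPoly_eval_zero_of_odd {p : ℕ} (hp : Odd p) (q : ℝ) : (gPoly p q).eval 0 = 0 := by
  have h := gPoly_eval_neg p q 0
  rw [hp.neg_one_pow, neg_zero] at h
  linarith

/-- With g'_{p+1,q} replaced by (p+1)q g_{p,q-2}, every term of the recursion is nonnegative. The
threshold p - 1 is preserved by (p+2, q) ↦ (p, q-2), and it is low enough to give g' ≥ 0 for q = p +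
ν down to ν = 0. -/
theorem gPoly_eval_nonneg (p : ℕ) : ∀ (q : ℝ), (p : ℝ) - 1 ≤ q → ∀ t ∈ Set.Icc (0 : ℝ) 1,
    0 ≤ (gPoly p q).eval t := by
  induction p using Nat.strong_induction_on with
  | _ p ih =>
    intro q hq t ht
    have ht2 : 0 ≤ 1 - t ^ 2 := by nlinarith [ht.1, ht.2]
    match p, ih, hq with
    | 0, _, _ => simp [gPoly]
    | 1, _, hq =>
      have : 0 ≤ q := by simpa using hq
      simpa [gPoly] using mul_nonneg this ht.1
    | p + 2, ih, hq =>
      push_cast at hq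
      have h1 := ih (p + 1) (by omega) q (by push_cast; linarith) t ht
      have h2 := ih p (by omega) (q - 2) (by linarith) t ht
      have hp : (0 : ℝ) ≤ p := p.cast_nonneg
      rw [gPoly_succ, derivative_gPoly_succ]
      simp only [eval_add, eval_mul, eval_sub, eval_one, eval_pow, eval_X, eval_C]
      push_cast
      have hq0 : 0 ≤ q := by linarith
      have hqp : 0 ≤ q - (p + 1) := by linarith
      have ht0 := ht.1
      positivity

theorem gPoly_derivative_nonneg (p : ℕ) {ν : ℝ} (hν : 0 ≤ ν) {t : ℝ}
    (ht : t ∈ Set.Icc (0 : ℝ) 1) : 0 ≤ (derivative (gPoly p (p + ν))).eval t := by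
  rcases p with _ | p
  · simp [gPoly]
  · rw [derivative_gPoly_succ]
    have := gPoly_eval_nonneg p (((p + 1 : ℕ) : ℝ) + ν - 2) (by push_cast; linarith) t ht
    simp only [eval_mul, eval_C]
    positivity

theorem gPoly_monotoneOn (p : ℕ) {ν : ℝ} (hν : 0 ≤ ν) :
    MonotoneOn (fun t => (gPoly p (p + ν)).eval t) (Set.Icc 0 1) := by
  refine monotoneOn_of_deriv_nonneg (convex_Icc 0 1) (gPoly p (p + ν)).continuous.continuousOn
    (gPoly p (p + ν)).differentiable.differentiableOn fun t ht => ?_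
  rw [Polynomial.deriv]
  exact gPoly_derivative_nonneg p hν (interior_subset ht)

theorem gPoly_ode_eval (p : ℕ) (ν t : ℝ) :
    (1 - t ^ 2) * (derivative (derivative (gPoly p (p + ν)))).eval t
      + (p + ν - 1) * t * (derivative (gPoly p (p + ν))).eval t
      = p * ν * (gPoly p (p + ν)).eval t := by
  have h := congrArg (eval t) (gPoly_ode p (p + ν))
  simp only [eval_add, eval_mul, eval_sub, eval_one, eval_pow, eval_X, eval_C, eval_zero] at h
  linear_combination h

end NormPower

/-! ### The Hölder constant of g on [0,1] is at most g(1). -/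

namespace NormPower

open Polynomial Filter Topology

theorem second_deriv_nonpos_of_isLocalMax {f f' : ℝ → ℝ} {f'' x : ℝ} (h : IsLocalMax f x)
    (hf : ∀ᶠ y in 𝓝 x, HasDerivAt f (f' y) y) (hf' : HasDerivAt f' f'' x) : f'' ≤ 0 := by
  -- A positive second derivative would make x a local minimum as well, hence f locally constant.
  by_contra! hpos
  have hd : deriv f =ᶠ[𝓝 x] f' := hf.mono fun y hy => hy.deriv
  have hdd : deriv (deriv f) x = f'' := by rw [hd.deriv_eq, hf'.deriv]
  have hmin := isLocalMin_of_deriv_deriv_pos (hdd ▸ hpos) h.deriv_eq_zero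
    hf.self_of_nhds.continuousAt
  have hconst : f =ᶠ[𝓝 x] fun _ => f x := by
    filter_upwards [h, hmin] with y h1 h2 using le_antisymm h1 h2
  have : deriv (deriv f) x = 0 := by
    rw [hconst.deriv.deriv_eq]
    simp
  linarith

/-- Bernoulli's inequality for d^{1-ν}; it settles the boundary case t = 1 of `gPoly_eval_sub_le`.
-/
theorem one_le_rpow_sub_one_mul {ν d : ℝ} (hν0 : 0 ≤ ν) (hν1 : ν ≤ 1) (hd0 : 0 < d) :
    1 ≤ d ^ (ν - 1) * (1 - (1 - ν) * (1 - d)) := by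
  have h1 : d ^ (1 - ν) ≤ 1 - (1 - ν) * (1 - d) := by
    have := rpow_one_add_le_one_add_mul_self (s := d - 1) (p := 1 - ν) (by linarith)
      (by linarith) (by linarith)
    rw [add_sub_cancel] at this
    linarith
  have h2 : d ^ (ν - 1) * d ^ (1 - ν) = 1 := by
    rw [← Real.rpow_add hd0]; simp
  calc (1 : ℝ) = d ^ (ν - 1) * d ^ (1 - ν) := h2.symm
    _ ≤ _ := by gcongr

theorem hasDerivAt_rpow_sub_const (s ν : ℝ) {y : ℝ} (h : s < y) :
    HasDerivAt (fun y => (y - s) ^ ν) (ν * (y - s) ^ (ν - 1)) y := by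
  simpa using ((hasDerivAt_id y).sub_const s).rpow_const (p := ν) (Or.inl (sub_pos.2 h).ne')

theorem hasDerivAt_rpow_const_sub (t ν : ℝ) {y : ℝ} (h : y < t) :
    HasDerivAt (fun y => (t - y) ^ ν) (-(ν * (t - y) ^ (ν - 1))) y := by
  simpa using ((hasDerivAt_id y).const_sub t).rpow_const (p := ν) (Or.inl (sub_pos.2 h).ne')

/-- Bound at a right endpoint `t < 1` that maximises `g(t) - G (t - s)^ν`. -/
theorem gPoly_eval_le_of_isLocalMax {p : ℕ} {ν G s t : ℝ} (hν0 : 0 < ν) (hν1 : ν ≤ 1)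
    (hG : 0 ≤ G) (hs : 0 ≤ s) (hst : s < t) (ht : t ≤ 1)
    (h : IsLocalMax (fun y => (gPoly p (p + ν)).eval y - G * (y - s) ^ ν) t) :
    p * (gPoly p (p + ν)).eval t ≤ (p + ν - 1) * t * (G * (t - s) ^ (ν - 1)) := by
  set g := gPoly p (p + ν) with hg
  have hder : ∀ y, s < y → HasDerivAt (fun y => g.eval y - G * (y - s) ^ ν)
      ((derivative g).eval y - G * (ν * (y - s) ^ (ν - 1))) y := fun y hy =>
    (g.hasDerivAt y).sub ((hasDerivAt_rpow_sub_const s ν hy).const_mul G)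
  have h0 := h.hasDerivAt_eq_zero (hder t hst)
  have h2 := second_deriv_nonpos_of_isLocalMax h ((lt_mem_nhds hst).mono hder)
    (((derivative g).hasDerivAt t).sub
      (((hasDerivAt_rpow_sub_const s (ν - 1) hst).const_mul ν).const_mul G))
  have hpos : 0 ≤ G * (ν * ((1 - ν) * (t - s) ^ (ν - 1 - 1))) := by
    have := Real.rpow_nonneg (sub_pos.2 hst).le (ν - 1 - 1)
    have : 0 ≤ 1 - ν := by linarith
    positivity
  -- Concavity of (y - s)^ν turns the second order condition into g''(t) ≤ 0. With g'(t) from the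
  -- first order condition, the differential equation becomes the claim times ν.
  have hg2 : (derivative (derivative g)).eval t ≤ 0 := by linarith
  have ode := gPoly_ode_eval p ν t
  rw [← hg] at ode
  have ht2 : 0 ≤ 1 - t ^ 2 := by nlinarith
  have hg1 : (derivative g).eval t = G * (ν * (t - s) ^ (ν - 1)) := by linarith
  rw [hg1] at ode
  refine le_of_mul_le_mul_left ?_ hν0
  nlinarith [mul_nonneg ht2 (neg_nonneg.2 hg2)]

/-- Bound at a left endpoint `0 < s` that maximises `-g(s) - G (t - s)^ν`. -/
theorem le_gPoly_eval_of_isLocalMax {p : ℕ} {ν G s t : ℝ} (hν0 : 0 < ν) (hν1 : ν ≤ 1)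
    (hG : 0 ≤ G) (hs : 0 ≤ s) (hst : s < t) (ht : t ≤ 1)
    (h : IsLocalMax (fun y => -(gPoly p (p + ν)).eval y - G * (t - y) ^ ν) s) :
    (p + ν - 1) * s * (G * (t - s) ^ (ν - 1)) ≤ p * (gPoly p (p + ν)).eval s := by
  set g := gPoly p (p + ν) with hg
  have hder : ∀ y, y < t → HasDerivAt (fun y => -g.eval y - G * (t - y) ^ ν)
      (-(derivative g).eval y - G * -(ν * (t - y) ^ (ν - 1))) y := fun y hy =>
    (g.hasDerivAt y).neg.sub ((hasDerivAt_rpow_const_sub t ν hy).const_mul G)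
  have h0 := h.hasDerivAt_eq_zero (hder s hst)
  have h2 := second_deriv_nonpos_of_isLocalMax h ((gt_mem_nhds hst).mono hder)
    (((derivative g).hasDerivAt s).neg.sub
      (((hasDerivAt_rpow_const_sub t (ν - 1) hst).const_mul ν).neg.const_mul G))
  have hpos : 0 ≤ G * (ν * ((1 - ν) * (t - s) ^ (ν - 1 - 1))) := by
    have := Real.rpow_nonneg (sub_pos.2 hst).le (ν - 1 - 1)
    have : 0 ≤ 1 - ν := by linarith
    positivity
  have hg2 : 0 ≤ (derivative (derivative g)).eval s := by linarith
  have ode := gPoly_ode_eval p ν s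
  rw [← hg] at ode
  have hs2 : 0 ≤ 1 - s ^ 2 := by nlinarith
  have hg1 : (derivative g).eval s = G * (ν * (t - s) ^ (ν - 1)) := by linarith
  rw [hg1] at ode
  refine le_of_mul_le_mul_left ?_ hν0
  nlinarith [mul_nonneg hs2 hg2]

/-- `g_{p,p+ν}` is `ν`-Hölder on `[0,1]` with constant `g_{p,p+ν}(1)`. -/
theorem gPoly_eval_sub_le (p : ℕ) {ν : ℝ} (hν0 : 0 ≤ ν) (hν1 : ν ≤ 1) {s t : ℝ} (hs : 0 ≤ s)
    (hst : s ≤ t) (ht : t ≤ 1) :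
    (gPoly p (p + ν)).eval t - (gPoly p (p + ν)).eval s
      ≤ (gPoly p (p + ν)).eval 1 * (t - s) ^ ν := by
  have hnn : ∀ t ∈ Set.Icc (0 : ℝ) 1, 0 ≤ (gPoly p (p + ν)).eval t :=
    gPoly_eval_nonneg p _ (by linarith)
  have hG := hnn 1 (by simp)
  rcases hν0.eq_or_lt with rfl | hνpos
  · have h1 := gPoly_monotoneOn p le_rfl ⟨hs.trans hst, ht⟩ (by simp) ht
    have h2 := hnn s ⟨hs, hst.trans ht⟩
    simp only at h1
    rw [Real.rpow_zero]
    linarith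
  rcases p.eq_zero_or_pos with rfl | hp
  · have := Real.rpow_nonneg (sub_nonneg.2 hst) ν
    simpa [gPoly] using this
  have hp1 : (1 : ℝ) ≤ p := by exact_mod_cast hp
  set g := gPoly p (p + ν) with hg
  set G := g.eval 1 with hGdef
  by_contra! hcon
  -- A violating pair exists, so the maximum (a, b) of the excess Δ over this compact triangle is
  -- positive and has a < b.
  let K : Set (ℝ × ℝ) := (Set.Icc 0 1 ×ˢ Set.Icc 0 1) ∩ {z | z.1 ≤ z.2}
  have hK : IsCompact K := (isCompact_Icc.prod isCompact_Icc).inter_right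
    (isClosed_le continuous_fst continuous_snd)
  let Δ : ℝ × ℝ → ℝ := fun z => g.eval z.2 - g.eval z.1 - G * (z.2 - z.1) ^ ν
  have hΔ : Continuous Δ := by
    have h1 : Continuous fun z : ℝ × ℝ => (z.2 - z.1) ^ ν :=
      (continuous_snd.sub continuous_fst).rpow_const fun _ => Or.inr hν0
    exact ((g.continuous.comp continuous_snd).sub (g.continuous.comp continuous_fst)).sub
      (continuous_const.mul h1)
  have hmem : (s, t) ∈ K := ⟨⟨⟨hs, hst.trans ht⟩, ⟨hs.trans hst, ht⟩⟩, hst⟩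
  obtain ⟨⟨a, b⟩, hab, hmax⟩ := hK.exists_isMaxOn ⟨_, hmem⟩ hΔ.continuousOn
  have hpos : G * (b - a) ^ ν < g.eval b - g.eval a := by
    have h1 : Δ (s, t) ≤ Δ (a, b) := hmax hmem
    simp only [Δ] at h1
    linarith
  obtain ⟨⟨⟨ha0, ha1⟩, ⟨hb0, hb1⟩⟩, hle⟩ := hab
  simp only at ha0 ha1 hb0 hb1
  have hlt : a < b := by
    refine lt_of_le_of_ne hle fun h => ?_
    subst h
    simp [Real.zero_rpow hνpos.ne'] at hpos
  have hd : 0 < b - a := sub_pos.2 hlt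
  have hDd : (b - a) ^ ν = (b - a) ^ (ν - 1) * (b - a) := by
    rw [← Real.rpow_add_one hd.ne']; simp
  set D := (b - a) ^ (ν - 1) with hD
  have hDpos : 0 < D := Real.rpow_pos_of_pos hd _
  have hleft : (p + ν - 1) * a * (G * D) ≤ p * g.eval a := by
    rcases ha0.eq_or_lt with h | ha
    · rw [← h]
      have := hnn 0 (by simp)
      simp only [mul_zero, zero_mul]
      positivity
    · refine le_gPoly_eval_of_isLocalMax hνpos hν1 hG ha0 hlt hb1 ?_
      filter_upwards [Ioo_mem_nhds ha hlt] with y hy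
      have : Δ (y, b) ≤ Δ (a, b) :=
        hmax ⟨⟨⟨hy.1.le, hy.2.le.trans hb1⟩, ⟨hb0, hb1⟩⟩, hy.2.le⟩
      simp only [Δ] at this
      linarith
  have hcν : (p : ℝ) + ν - 1 ≤ p := by linarith
  have hp0 : (0 : ℝ) < p := by linarith
  rw [hDd] at hpos
  rcases hb1.lt_or_eq with hb | rfl
  -- For b < 1 both endpoint bounds hold; subtracting them gives p(g(b) - g(a)) ≤ (p+ν-1)GD(b-a) ≤
  -- pG(b-a)^ν, a contradiction.
  · have hright : p * g.eval b ≤ (p + ν - 1) * b * (G * D) := by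
      refine gPoly_eval_le_of_isLocalMax hνpos hν1 hG ha0 hlt hb1 ?_
      filter_upwards [Ioo_mem_nhds hlt hb] with y hy
      have : Δ (a, y) ≤ Δ (a, b) :=
        hmax ⟨⟨⟨ha0, ha1⟩, ⟨ha0.trans hy.1.le, hy.2.le⟩⟩, hy.1.le⟩
      simp only [Δ] at this
      linarith
    have h3 := mul_lt_mul_of_pos_left hpos hp0
    have h4 : 0 ≤ G * D * (b - a) := by positivity
    nlinarith [mul_le_mul_of_nonneg_right hcν h4]
  -- For b = 1 no condition at b is available, but g(b) = G. With the bound at a, it remains to show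
  -- p ≤ (p - (1-ν)a)D, which is Bernoulli plus (p-1) ≤ (p-1)D.
  · have hB := one_le_rpow_sub_one_mul hν0 hν1 hd
    rw [← hD] at hB
    have hD1 : 1 ≤ D := by
      have : 0 ≤ (1 - ν) * (1 - (1 - a)) := mul_nonneg (by linarith) (by linarith)
      nlinarith [mul_nonneg hDpos.le this]
    have h3 := mul_lt_mul_of_pos_left hpos hp0
    have h4 : (p : ℝ) ≤ (p - (1 - ν) * a) * D := by
      have : (p - 1) * 1 ≤ (p - 1) * D := by gcongr
      nlinarith
    rw [← hGdef] at h3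
    nlinarith [mul_le_mul_of_nonneg_left h4 hG]

end NormPower

/-! ### Hölder estimates for homogeneous functions with an axial profile. -/

namespace NormPower

open scoped RealInnerProductSpace

/-- The scalar core of the same-side estimate: a, b are the cosines of the angles with h, r₁, r₂ the
norms, d the distance of the points. -/
theorem sub_mul_rpow_le {k : ℝ → ℝ} {ν H : ℝ} (hν0 : 0 ≤ ν) (hν1 : ν ≤ 1) (hH : 0 ≤ H)
    (hmono : MonotoneOn k (Set.Icc 0 1)) (hk0 : k 0 = 0)
    (hHol : ∀ s t, 0 ≤ s → s ≤ t → t ≤ 1 → k t - k s ≤ H * (t - s) ^ ν)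
    {a b r₁ r₂ d : ℝ} (ha : a ∈ Set.Icc (0 : ℝ) 1) (hb : b ∈ Set.Icc (0 : ℝ) 1)
    (hr₁ : 0 ≤ r₁) (hr₂ : 0 ≤ r₂) (hd : 0 ≤ d) (hr : r₂ ≤ r₁ + d) (hab : r₂ * b - r₁ * a ≤ d)
    (hle : r₂ ≤ r₁ → r₂ * (b - a) ≤ d) :
    k b * r₂ ^ ν - k a * r₁ ^ ν ≤ H * d ^ ν := by
  have h0mem : (0 : ℝ) ∈ Set.Icc (0 : ℝ) 1 := by simp
  have hka : 0 ≤ k a := hk0 ▸ hmono h0mem ha ha.1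
  have hkb : 0 ≤ k b := hk0 ▸ hmono h0mem hb hb.1
  have hdν : 0 ≤ d ^ ν := Real.rpow_nonneg hd ν
  have hr₁ν : 0 ≤ r₁ ^ ν := Real.rpow_nonneg hr₁ ν
  have hr₂ν : 0 ≤ r₂ ^ ν := Real.rpow_nonneg hr₂ ν
  have hkbH : k b ≤ H * b ^ ν := by simpa [hk0] using hHol 0 b le_rfl hb.1 hb.2
  rcases le_or_gt r₂ r₁ with h | h
  · have hrr : r₂ ^ ν ≤ r₁ ^ ν := Real.rpow_le_rpow hr₂ h hν0
    have h1 : k b * r₂ ^ ν - k a * r₁ ^ ν ≤ (k b - k a) * r₂ ^ ν := by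
      nlinarith [mul_le_mul_of_nonneg_left hrr hka]
    rcases le_total b a with hba | hba
    · have : k b ≤ k a := hmono hb ha hba
      nlinarith [mul_nonneg hH hdν, mul_nonneg (sub_nonneg.2 this) hr₂ν]
    · calc _ ≤ (k b - k a) * r₂ ^ ν := h1
        _ ≤ H * (b - a) ^ ν * r₂ ^ ν := by gcongr; exact hHol a b ha.1 hba hb.2
        _ = H * (r₂ * (b - a)) ^ ν := by
          rw [Real.mul_rpow hr₂ (sub_nonneg.2 hba)]; ring
        _ ≤ H * d ^ ν := by
          gcongr
          exact hle h
  · have hr₂pos : 0 < r₂ := hr₁.trans_lt h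
    rcases le_total b a with hba | hba
    · have h1 : k b ≤ k a := hmono hb ha hba
      have h2 : r₂ ^ ν ≤ r₁ ^ ν + d ^ ν :=
        (Real.rpow_le_rpow hr₂ hr hν0).trans (Real.rpow_add_le_add_rpow hr₁ hd hν0 hν1)
      have h3 : b ^ ν ≤ 1 := Real.rpow_le_one hb.1 hb.2 hν0
      have h4 : k b ≤ H := hkbH.trans (by nlinarith)
      calc k b * r₂ ^ ν - k a * r₁ ^ ν ≤ k b * (r₁ ^ ν + d ^ ν) - k b * r₁ ^ ν := by gcongr
        _ = k b * d ^ ν := by ring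
        _ ≤ H * d ^ ν := by gcongr
    -- Since r ≤ r^ν, k(b) - r^ν k(a) ≤ (1-r)k(b) + r(k(b) - k(a)). The Hölder bounds on (0,b) and
    -- (a,b) are then merged by concavity, because (1-r)b + r(b-a) = b - ra.
    · obtain ⟨r, hr0, hr1, rfl⟩ : ∃ r, 0 ≤ r ∧ r ≤ 1 ∧ r₁ = r * r₂ :=
        ⟨r₁ / r₂, by positivity, (div_le_one hr₂pos).2 h.le, by field_simp⟩
      have hconc := (Real.concaveOn_rpow hν0 hν1).2 (x := b) (y := b - a) hb.1
        (sub_nonneg.2 hba) (sub_nonneg.2 hr1) hr0 (by ring)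
      simp only [smul_eq_mul] at hconc
      rw [show (1 - r) * b + r * (b - a) = b - r * a by ring] at hconc
      have hrν : r ≤ r ^ ν := by
        rcases hr0.eq_or_lt with h | h
        · rw [← h]; exact Real.rpow_nonneg le_rfl _
        · simpa using Real.rpow_le_rpow_of_exponent_ge h hr1 hν1
      have hbra : 0 ≤ b - r * a := by nlinarith [ha.1]
      have hend := hHol a b ha.1 hba hb.2
      have key : k b - k a * r ^ ν ≤ H * (b - r * a) ^ ν := by
        have h1 := mul_le_mul_of_nonneg_left hconc hH
        have h2 := mul_le_mul_of_nonneg_left hrν hka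
        have h3 := mul_le_mul_of_nonneg_left hend hr0
        have h4 := mul_le_mul_of_nonneg_left hkbH (sub_nonneg.2 hr1)
        linarith
      calc k b * r₂ ^ ν - k a * (r * r₂) ^ ν = (k b - k a * r ^ ν) * r₂ ^ ν := by
            rw [Real.mul_rpow hr0 hr₂]; ring
        _ ≤ H * (b - r * a) ^ ν * r₂ ^ ν := by gcongr
        _ = H * ((b - r * a) * r₂) ^ ν := by rw [Real.mul_rpow hbra hr₂]; ring
        _ ≤ H * d ^ ν := by
          gcongr
          linarith

variable {E : Type*} [NormedAddCommGroup E] [InnerProductSpace ℝ E]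

/-- The positively `ν`-homogeneous function with profile `g` along the axis `h`. -/
noncomputable def axial (g : ℝ → ℝ) (ν : ℝ) (h x : E) : ℝ := g (⟪x, h⟫ / ‖x‖) * ‖x‖ ^ ν

/-- Projection onto the ball of radius ‖y‖ fixes y and is nonexpansive. -/
theorem norm_sub_rescale_le {x y : E} (hx : x ≠ 0) (h : ‖y‖ ≤ ‖x‖) :
    ‖y - (‖y‖ / ‖x‖) • x‖ ≤ ‖y - x‖ := by
  have hxpos : 0 < ‖x‖ := norm_pos_iff.2 hx
  set κ := ‖y‖ / ‖x‖ with hκ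
  have hκx : κ * ‖x‖ = ‖y‖ := by rw [hκ]; field_simp
  have hκ1 : κ ≤ 1 := (div_le_one hxpos).2 h
  have hin : ⟪y, x⟫ ≤ ‖y‖ * ‖x‖ := real_inner_le_norm y x
  refine le_of_sq_le_sq ?_ (norm_nonneg _)
  rw [norm_sub_sq_real, norm_sub_sq_real, norm_smul, inner_smul_right, Real.norm_eq_abs, mul_pow,
    sq_abs, ← mul_pow, hκx]
  have h1 := mul_le_mul_of_nonneg_left hin (sub_nonneg.2 hκ1)
  have h2 : κ * (‖y‖ * ‖x‖) = ‖y‖ ^ 2 := by rw [← hκx]; ring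
  nlinarith [sq_nonneg (‖x‖ - ‖y‖)]

theorem inner_div_norm_le_one {h : E} (hh : ‖h‖ = 1) (x : E) : ⟪x, h⟫ / ‖x‖ ≤ 1 := by
  refine div_le_one_of_le₀ ?_ (norm_nonneg _)
  simpa [hh] using real_inner_le_norm x h

theorem norm_mul_inner_div_norm (h x : E) : ‖x‖ * (⟪x, h⟫ / ‖x‖) = ⟪x, h⟫ := by
  rcases eq_or_ne x 0 with rfl | hx
  · simp
  · have := norm_ne_zero_iff.2 hx
    field_simp

theorem inner_sub_le {h : E} (hh : ‖h‖ = 1) (x y : E) : ⟪y, h⟫ - ⟪x, h⟫ ≤ ‖y - x‖ := by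
  rw [← inner_sub_left]
  simpa [hh] using real_inner_le_norm (y - x) h

/-- Split g = g(0) + k. The constant part costs g(0)‖y-x‖^ν by subadditivity of t^ν, and k is
handled by `sub_mul_rpow_le`. -/
theorem axial_sub_le_of_inner_nonneg {g : ℝ → ℝ} {ν H : ℝ} (hν0 : 0 ≤ ν) (hν1 : ν ≤ 1)
    (hH : 0 ≤ H) (hmono : MonotoneOn g (Set.Icc 0 1)) (hg0 : 0 ≤ g 0)
    (hHol : ∀ s t, 0 ≤ s → s ≤ t → t ≤ 1 → g t - g s ≤ H * (t - s) ^ ν)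
    {h x y : E} (hh : ‖h‖ = 1) (hx : 0 ≤ ⟪x, h⟫) (hy : 0 ≤ ⟪y, h⟫) :
    axial g ν h y - axial g ν h x ≤ (g 0 + H) * ‖y - x‖ ^ ν := by
  have hr : ‖y‖ ≤ ‖x‖ + ‖y - x‖ := by
    simpa using norm_add_le x (y - x)
  have hmain := sub_mul_rpow_le (k := fun t => g t - g 0) hν0 hν1 hH
    (fun s hs t ht hst => sub_le_sub_right (hmono hs ht hst) _) (sub_self _)
    (fun s t h1 h2 h3 => by simpa using hHol s t h1 h2 h3)
    (a := ⟪x, h⟫ / ‖x‖) (b := ⟪y, h⟫ / ‖y‖) (r₁ := ‖x‖) (r₂ := ‖y‖) (d := ‖y - x‖)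
    ⟨by positivity, inner_div_norm_le_one hh x⟩ ⟨by positivity, inner_div_norm_le_one hh y⟩
    (norm_nonneg _) (norm_nonneg _) (norm_nonneg _) hr
    (by simpa only [norm_mul_inner_div_norm] using inner_sub_le hh x y)
    (by
      intro hle
      rcases eq_or_ne x 0 with rfl | hx0
      · have : ‖y‖ = 0 := le_antisymm (by simpa using hle) (norm_nonneg _)
        simp [this]
      · have h1 := inner_sub_le hh ((‖y‖ / ‖x‖) • x) y
        refine le_trans (le_of_eq ?_) (h1.trans (norm_sub_rescale_le hx0 hle))
        rw [mul_sub, norm_mul_inner_div_norm, inner_smul_left]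
        simp
        ring)
  have h2 : ‖y‖ ^ ν ≤ ‖x‖ ^ ν + ‖y - x‖ ^ ν :=
    (Real.rpow_le_rpow (norm_nonneg _) hr hν0).trans
      (Real.rpow_add_le_add_rpow (norm_nonneg _) (norm_nonneg _) hν0 hν1)
  have h3 := mul_le_mul_of_nonneg_left h2 hg0
  unfold axial
  linarith

theorem axial_neg_of_even {g : ℝ → ℝ} (hg : ∀ t, g (-t) = g t) (ν : ℝ) (h x : E) :
    axial g ν h (-x) = axial g ν h x := by
  simp [axial, neg_div, hg]

theorem axial_neg_of_odd {g : ℝ → ℝ} (hg : ∀ t, g (-t) = -g t) (ν : ℝ) (h x : E) :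
    axial g ν h (-x) = -axial g ν h x := by
  simp [axial, neg_div, hg]

theorem axial_sub_le_of_even {g : ℝ → ℝ} {ν H : ℝ} (hν0 : 0 ≤ ν) (hν1 : ν ≤ 1)
    (hH : 0 ≤ H) (hmono : MonotoneOn g (Set.Icc 0 1)) (hg0 : 0 ≤ g 0)
    (hHol : ∀ s t, 0 ≤ s → s ≤ t → t ≤ 1 → g t - g s ≤ H * (t - s) ^ ν)
    (hg : ∀ t, g (-t) = g t) {h : E} (hh : ‖h‖ = 1) (x y : E) :
    axial g ν h y - axial g ν h x ≤ (g 0 + H) * ‖y - x‖ ^ ν := by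
  wlog hy : 0 ≤ ⟪y, h⟫ generalizing x y
  · have := this (-x) (-y) (by rw [inner_neg_left]; linarith)
    rwa [axial_neg_of_even hg, axial_neg_of_even hg, neg_sub_neg, norm_sub_rev] at this
  rcases le_total 0 ⟪x, h⟫ with hx | hx
  · exact axial_sub_le_of_inner_nonneg hν0 hν1 hH hmono hg0 hHol hh hx hy
  have hhh : ⟪h, h⟫ = 1 := by rw [real_inner_self_eq_norm_sq, hh]; norm_num
  -- The reflection of x in h^⊥ keeps the value, as g is even, and is no farther from y.
  set z := x - (2 * ⟪x, h⟫) • h with hz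
  have hzh : ⟪z, h⟫ = -⟪x, h⟫ := by
    rw [hz, inner_sub_left, inner_smul_left, hhh]; simp; ring
  have hzn : ‖z‖ = ‖x‖ := by
    rw [← sq_eq_sq₀ (norm_nonneg _) (norm_nonneg _), hz, norm_sub_sq_real, inner_smul_right,
      norm_smul, hh, mul_one, Real.norm_eq_abs, sq_abs]
    ring
  have hzx : axial g ν h z = axial g ν h x := by
    simp only [axial, hzn, hzh, neg_div, hg]
  have hdist : ‖y - z‖ ≤ ‖y - x‖ := by
    refine le_of_sq_le_sq ?_ (norm_nonneg _)
    rw [norm_sub_sq_real y z, norm_sub_sq_real y x, hzn, hz, inner_sub_right, inner_smul_right]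
    nlinarith [mul_nonneg hy (neg_nonneg.2 hx)]
  rw [← hzx]
  refine (axial_sub_le_of_inner_nonneg hν0 hν1 hH hmono hg0 hHol hh
    (by rw [hzh]; linarith) hy).trans ?_
  gcongr

theorem axial_sub_le_of_odd {g : ℝ → ℝ} {ν H : ℝ} (hν0 : 0 ≤ ν) (hν1 : ν ≤ 1)
    (hH : 0 ≤ H) (hmono : MonotoneOn g (Set.Icc 0 1))
    (hHol : ∀ s t, 0 ≤ s → s ≤ t → t ≤ 1 → g t - g s ≤ H * (t - s) ^ ν)
    (hg : ∀ t, g (-t) = -g t) {h : E} (hh : ‖h‖ = 1) (x y : E) :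
    axial g ν h y - axial g ν h x ≤ 2 ^ (1 - ν) * H * ‖y - x‖ ^ ν := by
  have hg0 : g 0 = 0 := by have := hg 0; rw [neg_zero] at this; linarith
  have half : ∀ x y : E, 0 ≤ ⟪x, h⟫ → 0 ≤ ⟪y, h⟫ →
      axial g ν h y - axial g ν h x ≤ H * ‖y - x‖ ^ ν := fun x y hx hy => by
    simpa [hg0] using axial_sub_le_of_inner_nonneg hν0 hν1 hH hmono hg0.ge hHol hh hx hy
  have htwo : (1 : ℝ) ≤ 2 ^ (1 - ν) := Real.one_le_rpow (by norm_num) (by linarith)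
  have hmono2 : H * ‖y - x‖ ^ ν ≤ 2 ^ (1 - ν) * H * ‖y - x‖ ^ ν := by
    have : 0 ≤ H * ‖y - x‖ ^ ν := by positivity
    nlinarith
  have hnonneg : ∀ x : E, 0 ≤ ⟪x, h⟫ → 0 ≤ axial g ν h x := fun x hx => by
    have hmem : ⟪x, h⟫ / ‖x‖ ∈ Set.Icc (0 : ℝ) 1 :=
      ⟨by positivity, inner_div_norm_le_one hh x⟩
    have := hmono (by simp) hmem hmem.1
    rw [hg0] at this
    unfold axial
    positivity
  rcases le_total 0 ⟪x, h⟫ with hx | hx <;> rcases le_total 0 ⟪y, h⟫ with hy | hy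
  · exact (half x y hx hy).trans hmono2
  · have h1 := hnonneg x hx
    have h2 := hnonneg (-y) (by rw [inner_neg_left]; linarith)
    rw [axial_neg_of_odd hg] at h2
    have : 0 ≤ 2 ^ (1 - ν) * H * ‖y - x‖ ^ ν := by positivity
    linarith
  · rcases eq_or_lt_of_le hy with hy0 | hypos
    · have h1 := half (-y) (-x) (by rw [inner_neg_left]; linarith)
        (by rw [inner_neg_left]; linarith)
      rw [axial_neg_of_odd hg, axial_neg_of_odd hg, neg_sub_neg, neg_sub_neg] at h1
      linarith
    have hpos : 0 < ⟪y, h⟫ - ⟪x, h⟫ := by linarith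
    -- θ locates the point z where the segment meets h^⊥; there the function vanishes. The two
    -- pieces have lengths θ‖y-x‖ and (1-θ)‖y-x‖, and the sum of their ν-th powers is largest at θ =
    -- 1/2.
    set θ := ⟪y, h⟫ / (⟪y, h⟫ - ⟪x, h⟫) with hθ
    have hθ0 : 0 ≤ θ := by positivity
    have hθ1 : θ ≤ 1 := (div_le_one hpos).2 (by linarith)
    set z := y - θ • (y - x) with hz
    have hzh : ⟪z, h⟫ = 0 := by
      rw [hz, inner_sub_left, inner_smul_left, inner_sub_left, hθ]
      simp only [conj_trivial]
      field_simp
      ring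
    have h1 := half z y hzh.ge hy
    have h2 := half (-z) (-x) (by simp [hzh]) (by rw [inner_neg_left]; linarith)
    have hzz : axial g ν h z = 0 := by simp [axial, hzh, hg0]
    rw [axial_neg_of_odd hg, axial_neg_of_odd hg, hzz] at h2
    rw [hzz] at h1
    have hd1 : y - z = θ • (y - x) := by rw [hz]; abel
    have hd2 : -x - -z = (1 - θ) • (y - x) := by rw [hz, sub_smul, one_smul]; abel
    rw [hd1, norm_smul, Real.norm_of_nonneg hθ0] at h1
    rw [hd2, norm_smul, Real.norm_of_nonneg (sub_nonneg.2 hθ1)] at h2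
    have hconc := (Real.concaveOn_rpow hν0 hν1).2 (x := θ * ‖y - x‖) (y := (1 - θ) * ‖y - x‖)
      (mul_nonneg hθ0 (norm_nonneg _)) (mul_nonneg (sub_nonneg.2 hθ1) (norm_nonneg _))
      (by norm_num : (0 : ℝ) ≤ 1 / 2) (by norm_num : (0 : ℝ) ≤ 1 / 2) (by norm_num)
    simp only [smul_eq_mul] at hconc
    rw [show 1 / 2 * (θ * ‖y - x‖) + 1 / 2 * ((1 - θ) * ‖y - x‖) = ‖y - x‖ / 2 by ring,
      Real.div_rpow (norm_nonneg _) (by norm_num)] at hconc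
    have h2ν : (2 : ℝ) ^ (1 - ν) = 2 / 2 ^ ν := by
      rw [Real.rpow_sub (by norm_num), Real.rpow_one]
    have : (θ * ‖y - x‖) ^ ν + ((1 - θ) * ‖y - x‖) ^ ν ≤ 2 ^ (1 - ν) * ‖y - x‖ ^ ν := by
      rw [h2ν, show 2 / (2 : ℝ) ^ ν * ‖y - x‖ ^ ν = 2 * (‖y - x‖ ^ ν / 2 ^ ν) by ring]
      linarith
    nlinarith [mul_le_mul_of_nonneg_left this hH]
  · have h1 := half (-y) (-x) (by rw [inner_neg_left]; linarith) (by rw [inner_neg_left]; linarith)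
    rw [axial_neg_of_odd hg, axial_neg_of_odd hg, neg_sub_neg, neg_sub_neg] at h1
    linarith

end NormPower

/-! ### Banach's theorem on symmetric multilinear forms. -/

namespace NormPower

open scoped RealInnerProductSpace

variable {E : Type*} [NormedAddCommGroup E] [InnerProductSpace ℝ E] {n : ℕ}

/-- A bound for a multilinear form on unit vectors extends to all vectors. -/
theorem abs_multilinear_le_of_unit (L : E [×n]→L[ℝ] ℝ) {M : ℝ}
    (hM : ∀ v : Fin n → E, (∀ i, ‖v i‖ = 1) → |L v| ≤ M) (v : Fin n → E) :
    |L v| ≤ M * ∏ i, ‖v i‖ := by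
  by_cases hv : ∃ i, v i = 0
  · obtain ⟨i, hi⟩ := hv
    rw [L.map_coord_zero i hi, Finset.prod_eq_zero (Finset.mem_univ i) (by simp [hi])]
    simp
  · push Not at hv
    have h1 := hM (fun i => ‖v i‖⁻¹ • v i) fun i => by
      rw [norm_smul, norm_inv, norm_norm, inv_mul_cancel₀ (norm_ne_zero_iff.2 (hv i))]
    rw [L.map_smul_univ, smul_eq_mul, abs_mul, Finset.prod_inv_distrib, abs_inv,
      abs_of_nonneg (Finset.prod_nonneg fun i _ => norm_nonneg _)] at h1
    have hpos : 0 < ∏ i, ‖v i‖ := Finset.prod_pos fun i _ => norm_pos_iff.2 (hv i)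
    rwa [inv_mul_le_iff₀ hpos, mul_comm] at h1

theorem norm_unit_add_lt_two {a b : E} (ha : ‖a‖ = 1) (hb : ‖b‖ = 1) (hab : a ≠ b) :
    ‖a + b‖ < 2 := by
  have h1 := parallelogram_law_with_norm ℝ a b
  have h2 : 0 < ‖a - b‖ := norm_pos_iff.2 (sub_ne_zero.2 hab)
  rw [ha, hb] at h1
  nlinarith [norm_nonneg (a + b)]

/-- If a symmetric form attains its norm `M` at a unit vector tuple with entries `a, b` in the
slots `i, j`, it also attains it after both are replaced by `(a + b) / ‖a + b‖`. -/
theorem abs_symmetric_form_midpoint (L : E [×n]→L[ℝ] ℝ)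
    (hsymm : ∀ (σ : Equiv.Perm (Fin n)) (v : Fin n → E), L (v ∘ σ) = L v) {M : ℝ}
    (hM : ∀ v : Fin n → E, |L v| ≤ M * ∏ i, ‖v i‖) {v : Fin n → E} (hv : ∀ i, ‖v i‖ = 1)
    (hLv : |L v| = M) {i j : Fin n} (hij : i ≠ j) (hne : v i + v j ≠ 0) {c : E}
    (hc : c = ‖v i + v j‖⁻¹ • (v i + v j)) :
    |L (Function.update (Function.update v i c) j c)| = M := by
  let B : E → E → ℝ := fun x y => L (Function.update (Function.update v i x) j y)
  have hBsymm : ∀ x y, B x y = B y x := fun x y => by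
    simp only [B]
    rw [← hsymm (Equiv.swap i j)]
    congr 1
    ext k
    simp only [Function.comp_apply]
    rcases eq_or_ne k i with rfl | hki
    · simp [hij]
    rcases eq_or_ne k j with rfl | hkj
    · simp [hij]
    · simp [Equiv.swap_apply_of_ne_of_ne hki hkj, hki, hkj]
  have hBadd : ∀ x y z, B x (y + z) = B x y + B x z := fun x y z => L.map_update_add _ j y z
  have hBadd' : ∀ x y z, B (x + y) z = B x z + B y z := fun x y z => by
    rw [hBsymm, hBadd, hBsymm z x, hBsymm z y]
  have hBsmul : ∀ (r : ℝ) x y, B x (r • y) = r * B x y := fun r x y => L.map_update_smul _ j r y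
  have hBsmul' : ∀ (r : ℝ) x y, B (r • x) y = r * B x y := fun r x y => by
    rw [hBsymm, hBsmul, hBsymm]
  have hBle : ∀ x, |B x x| ≤ M * ‖x‖ ^ 2 := fun x => by
    refine (hM _).trans (le_of_eq ?_)
    congr 1
    rw [← Finset.prod_subset (Finset.subset_univ {i, j}), Finset.prod_pair hij]
    · simp [hij, sq]
    · intro k _ hk
      simp only [Finset.mem_insert, Finset.mem_singleton, not_or] at hk
      simp [hk.1, hk.2, hv]
  have hBv : B (v i) (v j) = L v := by simp [B]
  set a := v i
  set b := v j
  have hneg : ∀ x y, B (x - y) (x - y) = B x x - 2 * B x y + B y y := fun x y => by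
    have h1 : x - y = x + (-1 : ℝ) • y := by simp [sub_eq_add_neg]
    rw [h1, hBadd, hBadd', hBadd', hBsmul, hBsmul', hBsmul, hBsmul', hBsymm y x]
    ring
  have hplus : B (a + b) (a + b) = B a a + 2 * B a b + B b b := by
    rw [hBadd, hBadd', hBadd', hBsymm b a]
    ring
  have hpar := parallelogram_law_with_norm ℝ a b
  have ha1 : ‖a‖ = 1 := hv i
  have hb1 : ‖b‖ = 1 := hv j
  rw [ha1, hb1] at hpar
  have h1 := hBle (a + b)
  have h2 := hBle (a - b)
  -- Polarization. Since ‖a+b‖² + ‖a-b‖² = 4, the bounds on both diagonal terms must be equalities.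
  have h3 : 4 * M ≤ |B (a + b) (a + b)| + |B (a - b) (a - b)| := by
    have : B (a + b) (a + b) - B (a - b) (a - b) = 4 * L v := by rw [hplus, hneg, ← hBv]; ring
    rw [← hLv]
    calc 4 * |L v| = |4 * L v| := by rw [abs_mul]; norm_num
      _ ≤ _ := by rw [← this]; exact abs_sub _ _
  have h4 : |B (a + b) (a + b)| = M * ‖a + b‖ ^ 2 := by
    refine le_antisymm h1 ?_
    rw [show ‖a - b‖ ^ 2 = 4 - ‖a + b‖ ^ 2 by linarith] at h2
    linarith
  have hnpos : 0 < ‖a + b‖ := norm_pos_iff.2 hne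
  change |B c c| = M
  rw [hc, hBsmul, hBsmul', ← mul_assoc, abs_mul, h4, abs_of_nonneg (by positivity)]
  field_simp

/-- Banach's theorem: the norm of a symmetric form on a Euclidean space is attained on the
diagonal. -/
theorem norm_le_of_diagonal [FiniteDimensional ℝ E] [Nontrivial E] (L : E [×n]→L[ℝ] ℝ)
    (hsymm : ∀ (σ : Equiv.Perm (Fin n)) (v : Fin n → E), L (v ∘ σ) = L v) {M : ℝ}
    (hM : ∀ h : E, ‖h‖ = 1 → |L fun _ => h| ≤ M) : ‖L‖ ≤ M := by
  let S : Set (Fin n → E) := Set.univ.pi fun _ => Metric.sphere 0 1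
  have hS : IsCompact S := isCompact_univ_pi fun _ => isCompact_sphere 0 1
  have hmemS : ∀ v, v ∈ S ↔ ∀ i, ‖v i‖ = 1 := fun v => by simp [S]
  obtain ⟨e, he⟩ := exists_norm_eq E zero_le_one
  have hLc : Continuous fun v => |L v| := L.cont.abs
  obtain ⟨v₀, hv₀, hmax⟩ := hS.exists_isMaxOn ⟨fun _ => e, (hmemS _).2 fun _ => he⟩ hLc.continuousOn
  set m := |L v₀| with hm
  have hbound : ∀ v : Fin n → E, |L v| ≤ m * ∏ i, ‖v i‖ :=
    abs_multilinear_le_of_unit L fun v hv => hmax ((hmemS v).2 hv)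
  suffices hdiag : ∃ h : E, ‖h‖ = 1 ∧ |L fun _ => h| = m by
    obtain ⟨h, hh, hL⟩ := hdiag
    exact (L.opNorm_le_bound (abs_nonneg _) hbound).trans (hL.symm.le.trans (hM h hh))
  rcases Nat.eq_zero_or_pos n with rfl | hn
  · exact ⟨e, he, by rw [hm]; congr 2; exact Subsingleton.elim _ _⟩
  let i₀ : Fin n := ⟨0, hn⟩
  let u := v₀ i₀
  let T : Set (Fin n → E) := S ∩ {v | |L v| = m}
  have hT : IsCompact T := hS.inter_right (isClosed_eq hLc continuous_const)
  -- Among the maximising tuples, one with largest Φ is constant. Sign flips make all ⟪v i, u⟫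
  -- nonnegative, and comparison with v₀ makes one positive. If some v j differed from that v i,
  -- replacing both by their normalized sum would increase Φ, because ‖v i + v j‖ < 2.
  let Φ : (Fin n → E) → ℝ := fun v => ∑ i, ⟪v i, u⟫
  have hΦ : Continuous Φ := by fun_prop
  obtain ⟨v, ⟨hvS, hvL⟩, hvmax⟩ := hT.exists_isMaxOn ⟨v₀, hv₀, rfl⟩ hΦ.continuousOn
  have hv := (hmemS v).1 hvS
  have hvL : |L v| = m := hvL
  have hflip : ∀ w ∈ T, ∑ i, |⟪w i, u⟫| ≤ Φ v := by
    intro w hw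
    let ε : Fin n → ℝ := fun i => if 0 ≤ ⟪w i, u⟫ then 1 else -1
    have hε : ∀ i, |ε i| = 1 := fun i => by by_cases h : 0 ≤ ⟪w i, u⟫ <;> simp [ε, h]
    have hmem : (fun i => ε i • w i) ∈ T := by
      refine ⟨(hmemS _).2 fun k => ?_, ?_⟩
      · rw [norm_smul, Real.norm_eq_abs, hε, one_mul]
        exact (hmemS w).1 hw.1 k
      · change |_| = m
        rw [L.map_smul_univ, smul_eq_mul, abs_mul, Finset.abs_prod]
        simp only [hε, Finset.prod_const_one, one_mul]
        exact hw.2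
    refine le_trans (le_of_eq ?_) (hvmax hmem)
    refine Finset.sum_congr rfl fun i _ => ?_
    rw [inner_smul_left]
    by_cases h : 0 ≤ ⟪w i, u⟫
    · simp [ε, h, abs_of_nonneg h]
    · simp [ε, h, abs_of_neg (not_le.1 h)]
  have Φ_update : ∀ (w : Fin n → E) i x,
      Φ (Function.update w i x) = Φ w - ⟪w i, u⟫ + ⟪x, u⟫ := by
    intro w i x
    simp only [Φ]
    rw [← Finset.add_sum_erase _ _ (Finset.mem_univ i),
      ← Finset.add_sum_erase (f := fun k => ⟪w k, u⟫) _ (Finset.mem_univ i)]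
    rw [Finset.sum_congr rfl (g := fun k => ⟪w k, u⟫) fun k hk => by
      rw [Function.update_of_ne (Finset.ne_of_mem_erase hk)]]
    simp
    ring
  have hnonneg : ∀ i, 0 ≤ ⟪v i, u⟫ := by
    intro i
    have h1 : ∑ k, (|⟪v k, u⟫| - ⟪v k, u⟫) ≤ 0 := by
      rw [Finset.sum_sub_distrib]
      exact sub_nonpos.2 (hflip v ⟨hvS, hvL⟩)
    have h2 := (Finset.single_le_sum (f := fun k => |⟪v k, u⟫| - ⟪v k, u⟫)
      (fun k _ => sub_nonneg.2 (le_abs_self _)) (Finset.mem_univ i)).trans h1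
    linarith [abs_nonneg ⟪v i, u⟫]
  obtain ⟨i, hi⟩ : ∃ i, 0 < ⟪v i, u⟫ := by
    by_contra! hcon
    have hΦv : Φ v ≤ 0 := Finset.sum_nonpos fun i _ => hcon i
    have huu : ⟪v₀ i₀, u⟫ = 1 := by
      rw [real_inner_self_eq_norm_sq, (hmemS v₀).1 hv₀ i₀]; norm_num
    have h1 := hflip v₀ ⟨hv₀, rfl⟩
    have h2 := Finset.single_le_sum (f := fun k => |⟪v₀ k, u⟫|)
      (fun k _ => abs_nonneg _) (Finset.mem_univ i₀)
    simp only [huu, abs_one] at h2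
    linarith
  refine ⟨v i, hv i, ?_⟩
  suffices hall : (fun _ => v i) = v by rw [hall, hvL]
  funext j
  by_contra hne
  have hij : i ≠ j := by rintro rfl; exact hne rfl
  have hsum : 0 < ⟪v i + v j, u⟫ := by rw [inner_add_left]; linarith [hnonneg j]
  have hsum0 : v i + v j ≠ 0 := by
    intro h0
    rw [h0, inner_zero_left] at hsum
    exact hsum.false
  set c := ‖v i + v j‖⁻¹ • (v i + v j) with hc
  have hcn : ‖c‖ = 1 := by
    rw [hc, norm_smul, norm_inv, norm_norm, inv_mul_cancel₀ (norm_ne_zero_iff.2 hsum0)]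
  have hmid := abs_symmetric_form_midpoint L hsymm hbound hv hvL hij hsum0 hc
  have hmemT : Function.update (Function.update v i c) j c ∈ T := by
    refine ⟨(hmemS _).2 fun k => ?_, hmid⟩
    rcases eq_or_ne k j with rfl | hkj
    · simpa using hcn
    rcases eq_or_ne k i with rfl | hki
    · simpa [hkj] using hcn
    · simpa [hkj, hki] using hv k
  have h1 : Φ _ ≤ Φ v := hvmax hmemT
  rw [Φ_update, Φ_update, Function.update_of_ne hij.symm, hc, inner_smul_left] at h1
  have hlt := norm_unit_add_lt_two (hv i) (hv j) hne
  have hnpos : 0 < ‖v i + v j‖ := norm_pos_iff.2 hsum0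
  have hinv : 2⁻¹ < ‖v i + v j‖⁻¹ := by gcongr
  have h2 := mul_lt_mul_of_pos_right hinv hsum
  rw [inner_add_left] at h1 h2
  simp only [conj_trivial] at h1
  linarith

end NormPower

/-! ### Smoothness of homogeneous functions and the derivatives of the norm power. -/

namespace NormPower

open scoped RealInnerProductSpace ContDiff
open Filter Topology

universe u v

section Homogeneous

variable {E : Type u} [NormedAddCommGroup E] [NormedSpace ℝ E]
  {G : Type v} [NormedAddCommGroup G] [NormedSpace ℝ G]

/-- `F` is positively homogeneous of degree `q`. -/
def PosHomogeneous (q : ℝ) (F : E → G) : Prop :=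
  ∀ t : ℝ, 0 < t → ∀ x, F (t • x) = t ^ q • F x

theorem PosHomogeneous.map_zero {q : ℝ} {F : E → G} (hF : PosHomogeneous q F) (hq : q ≠ 0) :
    F 0 = 0 := by
  have h := hF 2 two_pos 0
  rw [smul_zero] at h
  have h2 : (2 : ℝ) ^ q ≠ 1 := by
    intro h2
    have h3 := congrArg Real.log h2
    rw [Real.log_rpow two_pos, Real.log_one] at h3
    exact hq ((mul_eq_zero.1 h3).resolve_right (Real.log_pos one_lt_two).ne')
  have h3 : ((2 : ℝ) ^ q - 1) • F 0 = 0 := by rw [sub_smul, one_smul, ← h, sub_self]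
  exact (smul_eq_zero.1 h3).resolve_left (sub_ne_zero.2 h2)

theorem PosHomogeneous.fderiv {q : ℝ} {F : E → G} (hF : PosHomogeneous q F) :
    PosHomogeneous (q - 1) (fderiv ℝ F) := by
  intro t ht x
  have h1 : (fun y => F (t • y)) = t ^ q • F := funext fun y => hF t ht y
  have h2 : _root_.fderiv ℝ (fun y => F (t • y)) x = _root_.fderiv ℝ (t ^ q • F) x := by
    rw [h1]
  rw [fderiv_comp_smul, fderiv_const_smul_field, Pi.smul_apply] at h2
  rw [Real.rpow_sub_one ht.ne', div_eq_inv_mul, mul_smul, ← h2, smul_smul, inv_mul_cancel₀ ht.ne',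
    one_smul]

theorem PosHomogeneous.exists_norm_le [FiniteDimensional ℝ E] {q : ℝ} {F : E → G}
    (hF : PosHomogeneous q F) (hq : q ≠ 0) (hc : ∀ x, x ≠ 0 → ContinuousAt F x) :
    ∃ C, ∀ x, ‖F x‖ ≤ C * ‖x‖ ^ q := by
  have : ProperSpace E := FiniteDimensional.proper ℝ E
  obtain ⟨C, hC⟩ := (isCompact_sphere (0 : E) 1).exists_bound_of_continuousOn (f := F)
    fun x hx => (hc x (by rintro rfl; simp at hx)).continuousWithinAt
  refine ⟨C, fun x => ?_⟩
  rcases eq_or_ne x 0 with rfl | hx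
  · simp [hF.map_zero hq, Real.zero_rpow hq]
  have hpos : 0 < ‖x‖ := norm_pos_iff.2 hx
  have h1 := hF ‖x‖ hpos (‖x‖⁻¹ • x)
  rw [smul_inv_smul₀ hpos.ne'] at h1
  have h2 := hC (‖x‖⁻¹ • x) (by simp [norm_smul, hpos.ne'])
  rw [h1, norm_smul, Real.norm_of_nonneg (by positivity), mul_comm]
  gcongr

theorem PosHomogeneous.continuous [FiniteDimensional ℝ E] {q : ℝ} {F : E → G}
    (hF : PosHomogeneous q F) (hq : 0 < q) (hc : ∀ x, x ≠ 0 → ContinuousAt F x) :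
    Continuous F := by
  refine continuous_iff_continuousAt.2 fun x => ?_
  rcases eq_or_ne x 0 with rfl | hx
  · obtain ⟨C, hC⟩ := hF.exists_norm_le hq.ne' hc
    rw [ContinuousAt, hF.map_zero hq.ne']
    refine squeeze_zero_norm hC ?_
    have h1 : Continuous fun x : E => C * ‖x‖ ^ q :=
      continuous_const.mul (continuous_norm.rpow_const fun _ => Or.inr hq.le)
    simpa [Real.zero_rpow hq.ne'] using h1.tendsto 0
  · exact hc x hx

theorem PosHomogeneous.hasFDerivAt_zero [FiniteDimensional ℝ E] {q : ℝ} {F : E → G}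
    (hF : PosHomogeneous q F) (hq : 1 < q) (hc : ∀ x, x ≠ 0 → ContinuousAt F x) :
    HasFDerivAt F (0 : E →L[ℝ] G) 0 := by
  have hq0 : q ≠ 0 := by linarith
  obtain ⟨C, hC⟩ := hF.exists_norm_le hq0 hc
  rw [hasFDerivAt_iff_isLittleO_nhds_zero]
  simp only [zero_add, hF.map_zero hq0, sub_zero, _root_.zero_apply]
  have h1 : F =O[𝓝 0] fun x : E => ‖x‖ ^ q :=
    Asymptotics.IsBigO.of_bound C (Eventually.of_forall fun x => by
      rw [Real.norm_of_nonneg (Real.rpow_nonneg (norm_nonneg x) q)]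
      exact hC x)
  refine h1.trans_isLittleO ?_
  have h2 : (fun x : E => ‖x‖ ^ q) = fun x => ‖x‖ ^ (q - 1) * ‖x‖ := by
    ext x
    rw [← Real.rpow_add_one' (norm_nonneg x) (by linarith)]
    simp
  rw [h2]
  have h3 : Tendsto (fun x : E => ‖x‖ ^ (q - 1)) (𝓝 0) (𝓝 0) := by
    have : Continuous fun x : E => ‖x‖ ^ (q - 1) :=
      continuous_norm.rpow_const fun _ => Or.inr (by linarith)
    simpa [Real.zero_rpow (show q - 1 ≠ 0 by linarith)] using this.tendsto 0
  have h4 : (fun x : E => ‖x‖ ^ (q - 1)) =o[𝓝 0] fun _ => (1 : ℝ) :=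
    (Asymptotics.isLittleO_one_iff ℝ).2 h3
  have h5 := h4.mul_isBigO (Asymptotics.isBigO_refl (fun x : E => ‖x‖) (𝓝 0))
  simp only [one_mul] at h5
  exact h5.of_norm_right

theorem PosHomogeneous.contDiff_succ_of_fderiv [FiniteDimensional ℝ E] {q : ℝ} {F : E → G}
    (hF : PosHomogeneous q F) (hq : 1 < q) (hc : ∀ x, x ≠ 0 → ContDiffAt ℝ ∞ F x) {k : ℕ}
    (h : ContDiff ℝ k (_root_.fderiv ℝ F)) : ContDiff ℝ (k + 1 : ℕ) F := by
  push_cast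
  refine contDiff_succ_iff_fderiv.2 ⟨fun x => ?_, by simp, h⟩
  rcases eq_or_ne x 0 with rfl | hx
  · exact (hF.hasFDerivAt_zero hq fun x hx => (hc x hx).continuousAt).differentiableAt
  · exact (hc x hx).differentiableAt (by simp)

theorem contDiffAt_fderiv_of_infty {F : E → G} {x : E} (h : ContDiffAt ℝ ∞ F x) :
    ContDiffAt ℝ ∞ (fderiv ℝ F) x :=
  h.fderiv_right (by simp)

/-- Each derivative lowers the degree by one and changes the codomain to `E →L[ℝ] G`. The induction
must stay in one universe, hence G shares that of E. -/
theorem PosHomogeneous.contDiff_same_universe {E G : Type u} [NormedAddCommGroup E]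
    [NormedSpace ℝ E] [NormedAddCommGroup G] [NormedSpace ℝ G] [FiniteDimensional ℝ E]
    (k : ℕ) {q : ℝ} {F : E → G} (hF : PosHomogeneous q F) (hq : k < q)
    (hc : ∀ x, x ≠ 0 → ContDiffAt ℝ ∞ F x) : ContDiff ℝ k F := by
  induction k generalizing G q with
  | zero =>
    rw [Nat.cast_zero, contDiff_zero]
    exact hF.continuous (by simpa using hq) fun x hx => (hc x hx).continuousAt
  | succ k ih =>
    push_cast at hq
    have hk : (0 : ℝ) ≤ k := k.cast_nonneg
    exact hF.contDiff_succ_of_fderiv (by linarith) hc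
      (ih hF.fderiv (by linarith) fun x hx => contDiffAt_fderiv_of_infty (hc x hx))

/-- A positively homogeneous function of degree `q > k`, smooth off the origin, is `C^k`. -/
theorem PosHomogeneous.contDiff {E : Type u} [NormedAddCommGroup E] [NormedSpace ℝ E]
    [FiniteDimensional ℝ E] {k : ℕ} {q : ℝ} {F : E → ℝ} (hF : PosHomogeneous q F) (hq : k < q)
    (hc : ∀ x, x ≠ 0 → ContDiffAt ℝ ∞ F x) : ContDiff ℝ k F := by
  rcases k with _ | k
  · rw [Nat.cast_zero, contDiff_zero]
    exact hF.continuous (by simpa using hq) fun x hx => (hc x hx).continuousAt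
  -- One derivative taken by hand moves the values from ℝ to `E →L[ℝ] ℝ`, which lies in the universe
  -- of E.
  · push_cast at hq
    have hk : (0 : ℝ) ≤ k := k.cast_nonneg
    exact hF.contDiff_succ_of_fderiv (by linarith) hc
      (hF.fderiv.contDiff_same_universe k (by linarith)
        fun x hx => contDiffAt_fderiv_of_infty (hc x hx))

end Homogeneous

variable {E : Type*} [NormedAddCommGroup E] [InnerProductSpace ℝ E]

theorem contDiffAt_normPow {n : WithTop ℕ∞} (q : ℝ) {x : E} (hx : x ≠ 0) :
    ContDiffAt ℝ n (normPow E q) x :=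
  (contDiffAt_norm ℝ hx).rpow_const_of_ne (norm_ne_zero_iff.2 hx)

theorem posHomogeneous_normPow (q : ℝ) : PosHomogeneous q (normPow E q) := by
  intro t ht x
  rw [normPow, normPow, norm_smul, Real.norm_of_nonneg ht.le,
    Real.mul_rpow ht.le (norm_nonneg x), smul_eq_mul]

theorem contDiff_normPow [FiniteDimensional ℝ E] {p : ℕ} {ν : ℝ} (hν0 : 0 ≤ ν)
    (h : 0 < ν ∨ (Even p ∧ ν = 0)) : ContDiff ℝ p (normPow E (p + ν)) := by
  rcases h with h | ⟨⟨k, rfl⟩, rfl⟩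
  -- Homogeneity needs degree strictly above p; at ν = 0 with p even the function is a polynomial
  -- instead.
  · exact (posHomogeneous_normPow _).contDiff (by linarith) fun x hx => contDiffAt_normPow _ hx
  · have : normPow E (((k + k : ℕ) : ℝ) + 0) = fun x => (‖x‖ ^ 2) ^ k := by
      ext x
      rw [normPow, add_zero, Real.rpow_natCast, ← pow_mul, two_mul]
    rw [this]
    exact (contDiff_norm_sq ℝ).pow k

theorem hasDerivAt_norm_line {x : E} (hx : x ≠ 0) (h : E) :
    HasDerivAt (fun t : ℝ => ‖x + t • h‖) (⟪x, h⟫ / ‖x‖) 0 := by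
  have h1 : HasDerivAt (fun t : ℝ => x + t • h) h 0 := by
    simpa using ((hasDerivAt_id (0 : ℝ)).smul_const h).const_add x
  have h2 := h1.norm_sq.sqrt (by simpa using hx)
  simp only [Real.sqrt_sq (norm_nonneg _), zero_smul, add_zero] at h2
  convert h2 using 1
  ring

theorem hasDerivAt_inner_line (x : E) {h : E} (hh : ‖h‖ = 1) :
    HasDerivAt (fun t : ℝ => ⟪x + t • h, h⟫) 1 0 := by
  have : (fun t : ℝ => ⟪x + t • h, h⟫) = fun t => ⟪x, h⟫ + t := by
    ext t
    rw [inner_add_left, inner_smul_left, real_inner_self_eq_norm_sq, hh]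
    simp
  rw [this]
  exact (hasDerivAt_id (0 : ℝ)).const_add _

/-- The diagonal of the `p`-th derivative of `‖x‖^q` at a nonzero point. -/
theorem iteratedFDeriv_normPow_diag (p : ℕ) (q : ℝ) {h : E} (hh : ‖h‖ = 1) {x : E} (hx : x ≠ 0) :
    iteratedFDeriv ℝ p (normPow E q) x (fun _ => h)
      = (gPoly p q).eval (⟪x, h⟫ / ‖x‖) * ‖x‖ ^ (q - p) := by
  induction p generalizing x with
  | zero => simp [gPoly, normPow]
  | succ p ih =>
    have hdiff : DifferentiableAt ℝ (iteratedFDeriv ℝ p (normPow E q)) x :=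
      (contDiffAt_normPow (n := ∞) q hx).differentiableAt_iteratedFDeriv
        (by exact_mod_cast ENat.natCast_lt_top p)
    have hpos : 0 < ‖x‖ := norm_pos_iff.2 hx
    let e : (E [×p]→L[ℝ] ℝ) →L[ℝ] ℝ := ContinuousMultilinearMap.apply ℝ _ _ (fun _ => h)
    have hline : HasDerivAt (fun t : ℝ => x + t • h) h 0 := by
      simpa using ((hasDerivAt_id (0 : ℝ)).smul_const h).const_add x
    have hD : HasDerivAt (fun t : ℝ => iteratedFDeriv ℝ p (normPow E q) (x + t • h) (fun _ => h))
        (fderiv ℝ (iteratedFDeriv ℝ p (normPow E q)) x h (fun _ => h)) 0 := by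
      have hd' : HasFDerivAt (iteratedFDeriv ℝ p (normPow E q))
          (fderiv ℝ (iteratedFDeriv ℝ p (normPow E q)) x) (x + (0 : ℝ) • h) := by
        simpa using hdiff.hasFDerivAt
      exact (e.hasFDerivAt.comp_hasDerivAt (0 : ℝ) (hd'.comp_hasDerivAt (0 : ℝ) hline))
    have hne : ∀ᶠ t : ℝ in 𝓝 0, x + t • h ≠ 0 := by
      refine hline.continuousAt.eventually_ne ?_
      simpa using hx
    have hN := hasDerivAt_norm_line hx h
    have hτ := (hasDerivAt_inner_line x hh).div hN (by simpa using hpos.ne')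
    -- Along the line, τ has derivative (1 - τ²)/‖x‖ and the norm has derivative τ, which reproduces
    -- the recursion for g.
    have hP := (((gPoly p q).hasDerivAt _).comp (0 : ℝ) hτ).mul
      (hN.rpow_const (p := q - p) (Or.inl (by simpa using hpos.ne')))
    have hEq := hD.unique (hP.congr_of_eventuallyEq (hne.mono fun t ht => ih ht))
    rw [iteratedFDeriv_succ_apply_left]
    change fderiv ℝ (iteratedFDeriv ℝ p (normPow E q)) x h (fun _ => h) = _
    rw [hEq, gPoly_succ]
    simp only [Pi.div_apply, Function.comp_apply, zero_smul, add_zero, Polynomial.eval_add,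
      Polynomial.eval_mul, Polynomial.eval_sub, Polynomial.eval_one, Polynomial.eval_pow,
      Polynomial.eval_X, Polynomial.eval_C]
    have e1 : ‖x‖ ^ (q - p) = ‖x‖ ^ (q - p - 1) * ‖x‖ := by
      rw [← Real.rpow_add_one hpos.ne']; simp
    rw [show q - ((p + 1 : ℕ) : ℝ) = q - p - 1 by push_cast; ring, e1]
    field_simp

theorem posHomogeneous_iteratedFDeriv {p : ℕ} {q : ℝ} (h : ContDiff ℝ p (normPow E q)) :
    PosHomogeneous (q - p) (iteratedFDeriv ℝ p (normPow E q)) := by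
  intro t ht x
  have h1 : (fun z => normPow E q (t • z)) = fun z => t ^ q • normPow E q z :=
    funext fun z => posHomogeneous_normPow q t ht z
  have h2 := congrFun (iteratedFDeriv_comp_const_smul t h) x
  rw [h1, iteratedFDeriv_const_smul_apply' h.contDiffAt] at h2
  rw [Real.rpow_sub ht, Real.rpow_natCast, div_eq_inv_mul, mul_smul, h2, smul_smul,
    inv_mul_cancel₀ (pow_pos ht p).ne', one_smul]

/-- No differentiability is assumed, so this also fixes the value at 0 for ν = 0 and odd p:
composing with x ↦ -x forces it to equal its negative. -/
theorem iteratedFDeriv_zero_of_even_of_odd {f : E → ℝ} (hf : ∀ x, f (-x) = f x) {p : ℕ}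
    (hp : Odd p) : iteratedFDeriv ℝ p f 0 = 0 := by
  have h1 := (ContinuousLinearEquiv.neg ℝ (M := E)).iteratedFDerivWithin_comp_right f
    (s := Set.univ) uniqueDiffOn_univ (x := 0) (Set.mem_univ _) p
  have h2 : f ∘ (ContinuousLinearEquiv.neg ℝ (M := E)) = f := funext hf
  rw [h2, Set.preimage_univ, iteratedFDerivWithin_univ] at h1
  ext v
  have h3 := congrArg (fun L => L v) h1
  simp only [map_zero, ContinuousMultilinearMap.compContinuousLinearMap_apply] at h3
  have h4 : iteratedFDeriv ℝ p f 0 (fun i => -v i) = (-1) ^ p * iteratedFDeriv ℝ p f 0 v := by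
    have := (iteratedFDeriv ℝ p f 0).map_smul_univ (fun _ => (-1 : ℝ)) v
    simpa using this
  rw [hp.neg_one_pow] at h4
  have h5 : iteratedFDeriv ℝ p f 0 v = iteratedFDeriv ℝ p f 0 (fun i => -v i) := h3
  simp only [_root_.zero_apply]
  linarith

theorem iteratedFDeriv_normPow_zero [FiniteDimensional ℝ E] {p : ℕ} {ν : ℝ} (hν : 0 ≤ ν)
    (h : 0 < ν ∨ Odd p) : iteratedFDeriv ℝ p (normPow E (p + ν)) 0 = 0 := by
  rcases h with h | h
  · refine (posHomogeneous_iteratedFDeriv (contDiff_normPow hν (Or.inl h))).map_zero ?_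
    simpa using h.ne'
  · exact iteratedFDeriv_zero_of_even_of_odd (fun x => by simp [normPow]) h

/-- The derivative is homogeneous of degree 0, hence constant on open rays, and it is continuous at
0. -/
theorem iteratedFDeriv_normPow_eq_of_even [FiniteDimensional ℝ E] {p : ℕ} (hp : Even p) (x : E) :
    iteratedFDeriv ℝ p (normPow E (p + 0)) x = iteratedFDeriv ℝ p (normPow E (p + 0)) 0 := by
  have hC : ContDiff ℝ p (normPow E (p + 0)) := contDiff_normPow le_rfl (Or.inr ⟨hp, rfl⟩)
  have hhom := posHomogeneous_iteratedFDeriv hC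
  have h1 : Tendsto (fun t : ℝ => iteratedFDeriv ℝ p (normPow E (p + 0)) (t • x)) (𝓝[>] 0)
      (𝓝 (iteratedFDeriv ℝ p (normPow E (p + 0)) 0)) := by
    have hc : Continuous fun t : ℝ => iteratedFDeriv ℝ p (normPow E (p + 0)) (t • x) :=
      (hC.continuous_iteratedFDeriv le_rfl).comp (continuous_id.smul continuous_const)
    simpa using (hc.tendsto 0).mono_left nhdsWithin_le_nhds
  refine tendsto_nhds_unique (tendsto_const_nhds.congr' ?_) h1
  filter_upwards [self_mem_nhdsWithin] with t ht
  rw [hhom t ht x]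
  simp

theorem iteratedFDeriv_normPow_eq_axial [FiniteDimensional ℝ E] {p : ℕ} {ν : ℝ} (hν : 0 ≤ ν)
    (hp : 0 < ν ∨ Odd p) {h : E} (hh : ‖h‖ = 1) (x : E) :
    iteratedFDeriv ℝ p (normPow E (p + ν)) x (fun _ => h)
      = axial (fun t => (gPoly p (p + ν)).eval t) ν h x := by
  rcases eq_or_ne x 0 with rfl | hx
  · rw [iteratedFDeriv_normPow_zero hν hp]
    rcases hp with hp | hp
    · simp [axial, Real.zero_rpow hp.ne']
    -- Even if 0^ν = 1, the quotient 0/0 is 0 and the odd polynomial vanishes there.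
    · simp [axial, gPoly_eval_zero_of_odd hp]
  · rw [iteratedFDeriv_normPow_diag p _ hh hx, axial, add_sub_cancel_left]

theorem iteratedFDeriv_normPow_symm [FiniteDimensional ℝ E] {p : ℕ} {ν : ℝ} (hν : 0 ≤ ν)
    (hp : 0 < ν ∨ Odd p) (x : E) (σ : Equiv.Perm (Fin p)) (v : Fin p → E) :
    iteratedFDeriv ℝ p (normPow E (p + ν)) x (v ∘ σ)
      = iteratedFDeriv ℝ p (normPow E (p + ν)) x v := by
  rcases eq_or_ne x 0 with rfl | hx
  · simp [iteratedFDeriv_normPow_zero hν hp]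
  · exact (contDiffAt_normPow _ hx).iteratedFDeriv_comp_perm v σ

end NormPower

/-! ### The constants, the Hölder bound and the lower bounds. -/

namespace NormPower

variable {p : ℕ} {ν : ℝ}

theorem gPoly_eval_one_nonneg (hν0 : 0 ≤ ν) : 0 ≤ (gPoly p (p + ν)).eval 1 :=
  gPoly_eval_nonneg p _ (by linarith) 1 (by simp)

theorem gPoly_eval_zero_nonneg (hν0 : 0 ≤ ν) : 0 ≤ (gPoly p (p + ν)).eval 0 :=
  gPoly_eval_nonneg p _ (by linarith) 0 (by simp)

theorem gPoly_eval_zero_le_one (hν0 : 0 ≤ ν) :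
    (gPoly p (p + ν)).eval 0 ≤ (gPoly p (p + ν)).eval 1 :=
  gPoly_monotoneOn p hν0 (by simp) (by simp) zero_le_one

theorem le_of_mem_holderQuotients (hν0 : 0 ≤ ν) (hν1 : ν ≤ 1) {r : ℝ}
    (hr : r ∈ holderQuotients p ν) : r ≤ (gPoly p (p + ν)).eval 1 := by
  obtain ⟨s, t, hs, hst, ht, rfl⟩ := hr
  rw [div_le_iff₀ (Real.rpow_pos_of_pos (sub_pos.2 hst) ν)]
  exact gPoly_eval_sub_le p hν0 hν1 hs hst.le ht

theorem sub_mem_holderQuotients (p : ℕ) (ν : ℝ) :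
    (gPoly p (p + ν)).eval 1 - (gPoly p (p + ν)).eval 0 ∈ holderQuotients p ν :=
  ⟨0, 1, le_rfl, zero_lt_one, le_rfl, by simp⟩

theorem isLUB_hConst (hν0 : 0 ≤ ν) (hν1 : ν ≤ 1) : IsLUB (holderQuotients p ν) (hConst p ν) :=
  isLUB_csSup ⟨_, sub_mem_holderQuotients p ν⟩ ⟨_, fun _ => le_of_mem_holderQuotients hν0 hν1⟩

theorem hConst_le (hν0 : 0 ≤ ν) (hν1 : ν ≤ 1) : hConst p ν ≤ (gPoly p (p + ν)).eval 1 :=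
  (isLUB_hConst hν0 hν1).2 fun _ => le_of_mem_holderQuotients hν0 hν1

theorem hConst_nonneg (hν0 : 0 ≤ ν) (hν1 : ν ≤ 1) : 0 ≤ hConst p ν :=
  (sub_nonneg.2 (gPoly_eval_zero_le_one hν0)).trans
    ((isLUB_hConst hν0 hν1).1 (sub_mem_holderQuotients p ν))

theorem gPoly_eval_sub_le_hConst (hν0 : 0 ≤ ν) (hν1 : ν ≤ 1) (s t : ℝ) (hs : 0 ≤ s)
    (hst : s ≤ t) (ht : t ≤ 1) :
    (gPoly p (p + ν)).eval t - (gPoly p (p + ν)).eval s ≤ hConst p ν * (t - s) ^ ν := by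
  rcases hst.eq_or_lt with rfl | hlt
  · rw [sub_self]
    exact mul_nonneg (hConst_nonneg hν0 hν1) (Real.rpow_nonneg (by simp) _)
  · rw [← div_le_iff₀ (Real.rpow_pos_of_pos (sub_pos.2 hlt) ν)]
    exact (isLUB_hConst hν0 hν1).1 ⟨s, t, hs, hlt, ht, rfl⟩

theorem aConst_of_even (hp : Even p) (ν : ℝ) :
    aConst p ν = (gPoly p (p + ν)).eval 0 + hConst p ν := by
  rw [aConst, if_pos hp, gPoly_eval_zero_of_even hp]

theorem aTildeConst_of_even (hp : Even p) (ν : ℝ) :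
    aTildeConst p ν = (gPoly p (p + ν)).eval 0 + (gPoly p (p + ν)).eval 1 := by
  rw [aTildeConst, if_pos hp, gPoly_eval_zero_of_even hp, gPoly_eval_one_eq]

theorem aTildeConst_of_odd (hp : Odd p) (ν : ℝ) :
    aTildeConst p ν = 2 ^ (1 - ν) * (gPoly p (p + ν)).eval 1 := by
  rw [aTildeConst, if_neg (Nat.not_even_iff_odd.2 hp), gPoly_eval_one_eq]

theorem aConst_of_odd (hp : Odd p) (ν : ℝ) : aConst p ν = aTildeConst p ν := by
  rw [aConst, aTildeConst, if_neg (Nat.not_even_iff_odd.2 hp), if_neg (Nat.not_even_iff_odd.2 hp)]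

theorem aConst_nonneg (hν0 : 0 ≤ ν) (hν1 : ν ≤ 1) : 0 ≤ aConst p ν := by
  rcases p.even_or_odd with hp | hp
  · rw [aConst_of_even hp]
    exact add_nonneg (gPoly_eval_zero_nonneg hν0) (hConst_nonneg hν0 hν1)
  · rw [aConst_of_odd hp, aTildeConst_of_odd hp]
    exact mul_nonneg (by positivity) (gPoly_eval_one_nonneg hν0)

theorem aConst_le_aTildeConst (hν0 : 0 ≤ ν) (hν1 : ν ≤ 1) : aConst p ν ≤ aTildeConst p ν := by
  rcases p.even_or_odd with hp | hp
  · rw [aConst_of_even hp, aTildeConst_of_even hp]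
    exact add_le_add_right (hConst_le hν0 hν1) _
  · exact (aConst_of_odd hp ν).le

variable {E : Type*} [NormedAddCommGroup E] [InnerProductSpace ℝ E]

theorem axial_gPoly_sub_le (hν0 : 0 ≤ ν) (hν1 : ν ≤ 1) {h : E} (hh : ‖h‖ = 1) (x y : E) :
    axial (fun t => (gPoly p (p + ν)).eval t) ν h y
      - axial (fun t => (gPoly p (p + ν)).eval t) ν h x ≤ aConst p ν * ‖y - x‖ ^ ν := by
  rcases p.even_or_odd with hp | hp
  · rw [aConst_of_even hp]
    exact axial_sub_le_of_even hν0 hν1 (hConst_nonneg hν0 hν1) (gPoly_monotoneOn p hν0)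
      (gPoly_eval_zero_nonneg hν0) (gPoly_eval_sub_le_hConst hν0 hν1)
      (fun t => by simpa [hp.neg_one_pow] using gPoly_eval_neg p (p + ν) t) hh x y
  · rw [aConst_of_odd hp, aTildeConst_of_odd hp]
    exact axial_sub_le_of_odd hν0 hν1 (gPoly_eval_one_nonneg hν0) (gPoly_monotoneOn p hν0)
      (fun s t hs hst ht => gPoly_eval_sub_le p hν0 hν1 hs hst ht)
      (fun t => by simpa [hp.neg_one_pow] using gPoly_eval_neg p (p + ν) t) hh x y

theorem holderOnWithConst_aConst [FiniteDimensional ℝ E] (hν0 : 0 ≤ ν) (hν1 : ν ≤ 1) :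
    HolderOnWithConst (aConst p ν) ν (iteratedFDeriv ℝ p (normPow E (p + ν))) Set.univ := by
  intro x _ y _
  have hnn : 0 ≤ aConst p ν * ‖y - x‖ ^ ν :=
    mul_nonneg (aConst_nonneg hν0 hν1) (Real.rpow_nonneg (norm_nonneg _) _)
  rcases subsingleton_or_nontrivial E with _ | _
  · rw [Subsingleton.elim y x, sub_self, norm_zero]
    rwa [Subsingleton.elim y x] at hnn
  by_cases hp : 0 < ν ∨ Odd p
  · refine norm_le_of_diagonal _ (fun σ v => ?_) fun h hh => ?_
    · simp only [_root_.sub_apply, iteratedFDeriv_normPow_symm hν0 hp]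
    · rw [_root_.sub_apply, iteratedFDeriv_normPow_eq_axial hν0 hp hh,
        iteratedFDeriv_normPow_eq_axial hν0 hp hh, abs_sub_le_iff]
      refine ⟨axial_gPoly_sub_le hν0 hν1 hh x y, ?_⟩
      rw [norm_sub_rev]
      exact axial_gPoly_sub_le hν0 hν1 hh y x
  -- For ν = 0 and even p the derivative is constant and need not vanish at 0, so the axial formula
  -- is bypassed.
  · push Not at hp
    obtain rfl : ν = 0 := le_antisymm hp.1 hν0
    have he : Even p := Nat.not_odd_iff_even.1 hp.2
    rw [iteratedFDeriv_normPow_eq_of_even he y, iteratedFDeriv_normPow_eq_of_even he x, sub_self,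
      norm_zero]
    exact hnn

theorem iteratedFDeriv_normPow_self (p : ℕ) (ν : ℝ) {h : E} (hh : ‖h‖ = 1) :
    iteratedFDeriv ℝ p (normPow E (p + ν)) h (fun _ => h) = (gPoly p (p + ν)).eval 1 := by
  have hne : h ≠ 0 := by rintro rfl; simp at hh
  rw [iteratedFDeriv_normPow_diag p _ hh hne, real_inner_self_eq_norm_sq, hh]
  simp

theorem iteratedFDeriv_normPow_neg_self (p : ℕ) (ν : ℝ) {h : E} (hh : ‖h‖ = 1) :
    iteratedFDeriv ℝ p (normPow E (p + ν)) (-h) (fun _ => h)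
      = (-1) ^ p * (gPoly p (p + ν)).eval 1 := by
  have hne : -h ≠ 0 := by rw [neg_ne_zero]; rintro rfl; simp at hh
  rw [iteratedFDeriv_normPow_diag p _ hh hne, inner_neg_left, real_inner_self_eq_norm_sq, norm_neg,
    hh, ← gPoly_eval_neg]
  simp

theorem apply_diag_le_norm (L : ContinuousMultilinearMap ℝ (fun _ : Fin p => E) ℝ) {h : E}
    (hh : ‖h‖ = 1) : L (fun _ => h) ≤ ‖L‖ := by
  have := L.le_opNorm fun _ => h
  simp only [hh, Finset.prod_const_one, mul_one] at this
  exact (Real.le_norm_self _).trans this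

/-- The points ±h are at distance 2 and their diagonal values differ by 2g(1), so 2g(1) ≤ 2^ν M. -/
theorem aTildeConst_le_of_odd [Nontrivial E] (hp : Odd p) {M : ℝ}
    (hM : HolderOnWithConst M ν (iteratedFDeriv ℝ p (normPow E (p + ν))) {0}ᶜ) :
    aTildeConst p ν ≤ M := by
  obtain ⟨h, hh⟩ := exists_norm_eq E zero_le_one
  have hne : h ≠ 0 := by rintro rfl; simp at hh
  have h1 := (apply_diag_le_norm _ hh).trans (hM (-h) (by simpa using hne) h (by simpa using hne))
  rw [_root_.sub_apply, iteratedFDeriv_normPow_self p ν hh,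
    iteratedFDeriv_normPow_neg_self p ν hh, hp.neg_one_pow, sub_neg_eq_add, ← two_smul ℝ h,
    norm_smul, hh] at h1
  simp only [Real.norm_ofNat, mul_one] at h1
  rw [aTildeConst_of_odd hp, Real.rpow_sub two_pos, Real.rpow_one, div_mul_eq_mul_div,
    div_le_iff₀ (Real.rpow_pos_of_pos two_pos ν)]
  linarith

/-- The points 0 and h give g(1) ≤ M, and g(0) ≤ g(1) by monotonicity. -/
theorem aTildeConst_le_two_mul_of_even [FiniteDimensional ℝ E] [Nontrivial E] (hp : Even p)
    (hν : 0 < ν) {M : ℝ}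
    (hM : HolderOnWithConst M ν (iteratedFDeriv ℝ p (normPow E (p + ν))) Set.univ) :
    aTildeConst p ν ≤ 2 * M := by
  obtain ⟨h, hh⟩ := exists_norm_eq E zero_le_one
  have h1 := (apply_diag_le_norm _ hh).trans (hM 0 (Set.mem_univ _) h (Set.mem_univ _))
  rw [iteratedFDeriv_normPow_zero hν.le (Or.inl hν), sub_zero, sub_zero,
    iteratedFDeriv_normPow_self p ν hh, hh, Real.one_rpow, mul_one] at h1
  rw [aTildeConst_of_even hp]
  linarith [gPoly_eval_zero_le_one (p := p) hν.le]

end NormPower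

/-- `D^p f_{p+ν}` is `iteratedFDeriv ℝ p (normPow E (p + ν))`. It is a genuine derivative on all
of `E` if `0 < ν` or `p` is even. If `ν = 0` and `p` is odd it is one on `E \ {0}`, and at the
origin (of a nontrivial `E`) `iteratedFDeriv` takes the conventional value `0`. -/
theorem mainTheorem1 {E : Type*} [NormedAddCommGroup E] [InnerProductSpace ℝ E]
    [FiniteDimensional ℝ E] (p : ℕ) (ν : ℝ) (hν0 : 0 ≤ ν) (hν1 : ν ≤ 1) :
    -- the `p`-th derivative exists
    ((0 < ν ∨ Even p) → ContDiff ℝ p (normPow E (p + ν))) ∧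
    (∀ x : E, x ≠ 0 → ContDiffAt ℝ p (normPow E (p + ν)) x) ∧
    -- `H_{p,ν}` is a genuine (finite) supremum
    IsLUB (holderQuotients p ν) (hConst p ν) ∧
    -- Hölder continuity with constant `A_{p,ν}`, and consequently with `Ã_{p,ν}`
    HolderOnWithConst (aConst p ν) ν (iteratedFDeriv ℝ p (normPow E (p + ν))) Set.univ ∧
    aConst p ν ≤ aTildeConst p ν ∧
    HolderOnWithConst (aTildeConst p ν) ν (iteratedFDeriv ℝ p (normPow E (p + ν))) Set.univ ∧
    -- for odd `p`, `Ã_{p,ν}` is optimal, already for pairs of nonzero points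
    (Nontrivial E → Odd p → ∀ M : ℝ,
      HolderOnWithConst M ν (iteratedFDeriv ℝ p (normPow E (p + ν))) {0}ᶜ →
        aTildeConst p ν ≤ M) ∧
    -- for even `p` and `0 < ν`, `Ã_{p,ν}` is at most twice any admissible constant
    (Nontrivial E → Even p → 0 < ν → ∀ M : ℝ,
      HolderOnWithConst M ν (iteratedFDeriv ℝ p (normPow E (p + ν))) Set.univ →
        aTildeConst p ν ≤ 2 * M) := by
  have hA := NormPower.holderOnWithConst_aConst (E := E) (p := p) hν0 hν1
  have hle := NormPower.aConst_le_aTildeConst (p := p) hν0 hν1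
  refine ⟨fun h => ?_, fun x hx => NormPower.contDiffAt_normPow _ hx,
    NormPower.isLUB_hConst hν0 hν1, hA, hle, fun x hx y hy => (hA x hx y hy).trans ?_,
    fun _ hp M hM => NormPower.aTildeConst_le_of_odd hp hM,
    fun _ hp hν M hM => NormPower.aTildeConst_le_two_mul_of_even hp hν hM⟩
  · refine NormPower.contDiff_normPow hν0 ?_
    rcases hν0.eq_or_lt with h0 | hpos
    · exact h.imp_right fun hp => ⟨hp, h0.symm⟩
    · exact Or.inl hpos
  · gcongr
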